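/- Let $k\ge 0$ and $l,m\ge 1$ be integers. The ladder graph $G_o$ consists of $k+1$ rectangles placed side by side. Each rectangle has vertical sides of $m$ edges and horizontal sides of $l$ edges. The $n$-th and $(n+1)$-st rectangles share a vertical side $(0\le n<k)$. A start vertex $s$ is attached by one edge to the lower left corner of the $0$-th rectangle, and a goal vertex $g$ by one edge to its upper left corner. Regard $G_o$ as a symmetric digraph. Add one self-loop at $s$ (again denoted $s$) and one at $g$ (again denoted $g$), each its own inverse arc, and add a sink vertex joined to $s$ by an arc $d$ (from $s$ to the sink) and its inverse $\bar d$. Let $A$ be the resulting set of arcs. For $a\in A$ let $o(a)$, $t(a)$, $\bar a$ be its origin, terminal vertex and inverse, and let $\deg(v)=|\{a\in A: t(a)=v\}|$. The Grover walk on $\mathbb C^{A}$ is $$(U\psi)(a)=-\psi(\bar a)+\frac{2}{\deg(o(a))}\sum_{t(b)=o(a)}\psi(b),$$ and $V(-1)$ is its eigenspace for the eigenvalue $-1$. A navigation vector is a vector $\varphi$ with $\varphi(s)\ne0$ and $\varphi(d)=0$ that belongs to an orthonormal basis of $V(-1)$ all of whose other members vanish at $s$ and at $d$. There is a unique shortest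 path $a_1,\dots,a_r$ from $s$ to $g$ in $G_o$. Put $a_0=s$ and $a_{r+1}=g$ (the self-loops), and let $\xi$ be the normalization of the vector that equals $(-1)^i$ on $a_i$ and $\bar a_i$ for $0\le i\le r+1$ and $0$ on all other arcs. For $0\le n\le k$ let $\gamma_n$ be the normalization of the vector that equals $(-1)^i$ on $a_i$ and $\bar a_i$ and $0$ elsewhere, where $a_1,\dots,a_{2(l+m)}$ is the boundary cycle of the $n$-th rectangle; $\gamma_n$ is determined up to sign, and the signs can be chosen, and are chosen, such that $\langle\gamma_0,\xi\rangle\ge0$ and $\langle\gamma_n,\gamma_{n+1}\rangle\ge0$ for $0\le n<k$. Let $\psi_0,\dots,\psi_k,\varphi$ be obtained from $\gamma_0,\dots,\gamma_k,\xi$ by the Gram–Schmidt process, let $\Pi_k=\sum_{n=0}^k|\psi_n\rangle\langle\psi_n|$, let $\kappa=\frac{m}{2(l+m)}$ and $u_n=U_n\!\left(\frac1{2\kappa}\right)$, where $U_n(x)$ on the right is the Chebyshev polynomial of the second kind. Then $\varphi$ is a navigation vector, every navigation vector is a multiple of $\varphi$ by a complex number of modulus $1$, and $\|(I-\Pi_k)\xi\|>0$,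 $$\|(I-\Pi_k)\xi\|^2=1-\frac{m}{m+3}\sum_{n=0}^k\frac1{u_nu_{n+1}},$$ $$\varphi=\frac{1}{\|(I-\Pi_k)\xi\|}\left(\xi-\frac{\sqrt{2(l+m)}}{\sqrt{m+3}}\sum_{n=0}^k\frac{1}{u_nu_{n+1}}\sum_{j=0}^n(-1)^j u_j\gamma_j\right).$$ -/

import Mathlib

/-- The four arcs that are added to the arcs of the underlying graph: the self-loop at the start
vertex, the self-loop at the goal vertex, the arc from the start vertex to the sink, and the arc
from the sink to the start vertex. -/
inductive ExtraArc
  | startLoop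
  | goalLoop
  | toSink
  | fromSink
  deriving DecidableEq

instance : Fintype ExtraArc where
  elems := {.startLoop, .goalLoop, .toSink, .fromSink}
  complete := by rintro (_ | _ | _ | _) <;> simp

/-- The arcs of the maze digraph over the underlying graph `G`. -/
abbrev MazeArc {V : Type} (G : SimpleGraph V) : Type := G.Dart ⊕ ExtraArc

namespace Maze

section general

variable {V : Type} (G : SimpleGraph V) (s g : V)

/-- Origin of an arc; the vertices of the maze digraph are those of `G` and the sink `none`. -/
def origin : MazeArc G → Option V
  | .inl e => some e.fst
  | .inr .startLoop => some s
  | .inr .goalLoop => some g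
  | .inr .toSink => some s
  | .inr .fromSink => none

/-- The inverse arc; a self-loop is its own inverse. -/
def inverse : MazeArc G → MazeArc G
  | .inl e => .inl e.symm
  | .inr .startLoop => .inr .startLoop
  | .inr .goalLoop => .inr .goalLoop
  | .inr .toSink => .inr .fromSink
  | .inr .fromSink => .inr .toSink

/-- Terminal vertex of an arc. -/
def terminal (a : MazeArc G) : Option V := origin G s g (inverse G a)

variable [Fintype V] [DecidableEq V] [DecidableRel G.Adj]

/-- The Hilbert space of complex functions on the arcs. -/
abbrev Amp : Type := EuclideanSpace ℂ (MazeArc G)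

/-- Degree of a vertex of the maze digraph: the number of arcs that end there. -/
def deg (v : Option V) : ℕ :=
  (Finset.univ.filter fun a : MazeArc G => terminal G s g a = v).card

/-- The Grover walk
`(U ξ)(a) = - ξ(ā) + (2 / deg (o(a))) * ∑_{t(b) = o(a)} ξ(b)`. -/
noncomputable def grover : Amp G →ₗ[ℂ] Amp G where
  toFun ξ := WithLp.toLp 2 fun a =>
    - ξ (inverse G a) + 2 / (deg G s g (origin G s g a) : ℂ) *
      ∑ b ∈ Finset.univ.filter (fun b : MazeArc G => terminal G s g b = origin G s g a), ξ b
  map_add' x y := by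
    ext a
    simp only [PiLp.add_apply, Finset.sum_add_distrib]
    ring
  map_smul' c x := by
    ext a
    simp only [PiLp.smul_apply, smul_eq_mul, RingHom.id_apply, ← Finset.mul_sum]
    ring

/-- The eigenspace `V(-1)` of the Grover walk. -/
noncomputable abbrev eigenspaceNegOne : Submodule ℂ (Amp G) :=
  Module.End.eigenspace (grover G s g) (-1)

/-- `φ` is a navigation vector: `V(-1)` has an orthonormal basis whose last member is `φ`, where
`φ` is nonzero on the self-loop of the start vertex and vanishes on the arc to the sink, and where
all other members vanish on both of these arcs. -/
def IsNavigationVector (φ : Amp G) : Prop :=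
  ∃ (n : ℕ) (b : OrthonormalBasis (Fin (n + 1)) ℂ (eigenspaceNegOne G s g)),
    (b (Fin.last n) : Amp G) = φ ∧
    φ (.inr .startLoop) ≠ 0 ∧ φ (.inr .toSink) = 0 ∧
    ∀ i : Fin n, (b i.castSucc : Amp G) (.inr .startLoop) = 0 ∧
      (b i.castSucc : Amp G) (.inr .toSink) = 0

/-- The indicator function of the arcs that join `u` and `v`, in either direction. For adjacent
`u` and `v` these are an arc and its inverse, for `u = v = s` and `u = v = g` the self-loop. -/
noncomputable def stepVector (u v : V) : Amp G :=
  WithLp.toLp 2 fun a =>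
    if (origin G s g a = some u ∧ terminal G s g a = some v) ∨
        (origin G s g a = some v ∧ terminal G s g a = some u) then 1 else 0

/-- The alternating vector of a vertex sequence: if `a₀, a₁, …` are the arcs passed through in
order, its value is `(-1) ^ i` on `a_i` and on the inverse of `a_i`, and zero on all other arcs
(for sequences that use no edge twice). -/
noncomputable def alternating : List V → Amp G
  | u :: v :: L => stepVector G s g u v - alternating (v :: L)
  | _ => 0

/-- The vector divided by its norm. -/
noncomputable def normalize (x : Amp G) : Amp G := ((‖x‖⁻¹ : ℝ) : ℂ) • x

/-- The normalized vector of a path from the start to the goal: alternating along the self-loop at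
the start, the arcs of the path, and the self-loop at the goal. -/
noncomputable def pathVector (p : G.Walk s g) : Amp G :=
  normalize G (alternating G s g (s :: (p.support ++ [g])))

end general

/-- The points of the ladder in the integer plane: `k + 2` vertical sides at the abscissas
`0, l, …, (k + 1) * l`, each with `m` edges, joined by a bottom line at height `0` and a top line
at height `m`; the start `(0, -1)` below the lower left corner, and the goal `(0, m + 1)` above
the upper left corner. -/
noncomputable def ladderPoints (k l m : ℕ) : Finset (ℤ × ℤ) :=
  (Finset.Icc (0 : ℤ) (((k + 1) * l : ℕ) : ℤ) ×ˢ Finset.Icc (-1 : ℤ) ((m : ℤ) + 1)).filter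
    fun q => q.1 = 0 ∨ q.2 = 0 ∨ q.2 = (m : ℤ) ∨ ((l : ℤ) ∣ q.1 ∧ 0 ≤ q.2 ∧ q.2 ≤ (m : ℤ))

abbrev LadderVertex (k l m : ℕ) : Type := {q : ℤ × ℤ // q ∈ ladderPoints k l m}

section ladder

variable (k l m : ℕ)

/-- The ladder graph: vertical unit steps along the vertical sides (including the steps to the
start and to the goal), horizontal unit steps along the bottom line and along the top line. -/
def ladderGraph : SimpleGraph (LadderVertex k l m) where
  Adj p q :=
    (p.1.1 = q.1.1 ∧ (l : ℤ) ∣ p.1.1 ∧ (q.1.2 = p.1.2 + 1 ∨ p.1.2 = q.1.2 + 1)) ∨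
    (p.1.2 = q.1.2 ∧ (p.1.2 = 0 ∨ p.1.2 = (m : ℤ)) ∧ (q.1.1 = p.1.1 + 1 ∨ p.1.1 = q.1.1 + 1))
  symm := ⟨by
    rintro p q (⟨h1, h2, h3⟩ | ⟨h1, h2, h3⟩)
    · exact Or.inl ⟨h1.symm, h1 ▸ h2, h3.symm⟩
    · exact Or.inr ⟨h1.symm, h1 ▸ h2, h3.symm⟩⟩
  loopless := ⟨by
    rintro p (⟨_, _, h⟩ | ⟨_, _, h⟩) <;> omega⟩

instance : DecidableRel (ladderGraph k l m).Adj := fun p q =>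
  inferInstanceAs (Decidable (
    (p.1.1 = q.1.1 ∧ (l : ℤ) ∣ p.1.1 ∧ (q.1.2 = p.1.2 + 1 ∨ p.1.2 = q.1.2 + 1)) ∨
    (p.1.2 = q.1.2 ∧ (p.1.2 = 0 ∨ p.1.2 = (m : ℤ)) ∧ (q.1.1 = p.1.1 + 1 ∨ p.1.1 = q.1.1 + 1))))

/-- The start vertex. -/
def start : LadderVertex k l m :=
  ⟨(0, -1), by
    simp only [ladderPoints, Finset.mem_filter, Finset.mem_product, Finset.mem_Icc]
    refine ⟨by omega, by simp⟩⟩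

/-- The goal vertex. -/
def goal : LadderVertex k l m :=
  ⟨(0, (m : ℤ) + 1), by
    simp only [ladderPoints, Finset.mem_filter, Finset.mem_product, Finset.mem_Icc]
    refine ⟨by omega, by simp⟩⟩

variable {k l m}

/-- The vertex at height `y` on the `j`-th vertical side. -/
def side (j : Fin (k + 2)) (y : Fin (m + 1)) : LadderVertex k l m :=
  ⟨(((j * l : ℕ) : ℤ), (y : ℤ)), by
    have h : (j : ℕ) * l ≤ (k + 1) * l := Nat.mul_le_mul_right l (Nat.le_of_lt_succ j.2)
    have hd : (l : ℤ) ∣ (((j : ℕ) * l : ℕ) : ℤ) := by exact_mod_cast Dvd.intro_left _ rfl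
    simp only [ladderPoints, Finset.mem_filter, Finset.mem_product, Finset.mem_Icc]
    refine ⟨by omega, Or.inr (Or.inr (Or.inr ⟨hd, by omega, by omega⟩))⟩⟩

/-- The `i`-th vertex, from the left, on the bottom side of the `n`-th rectangle. -/
def bottom (n : Fin (k + 1)) (i : Fin (l + 1)) : LadderVertex k l m :=
  ⟨(((n * l + i : ℕ) : ℤ), 0), by
    have h : ((n : ℕ) + 1) * l ≤ (k + 1) * l := Nat.mul_le_mul_right l n.2
    rw [Nat.add_mul, one_mul] at h
    simp only [ladderPoints, Finset.mem_filter, Finset.mem_product, Finset.mem_Icc]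
    refine ⟨by omega, by simp⟩⟩

/-- The `i`-th vertex, from the left, on the top side of the `n`-th rectangle. -/
def top (n : Fin (k + 1)) (i : Fin (l + 1)) : LadderVertex k l m :=
  ⟨(((n * l + i : ℕ) : ℤ), (m : ℤ)), by
    have h : ((n : ℕ) + 1) * l ≤ (k + 1) * l := Nat.mul_le_mul_right l n.2
    rw [Nat.add_mul, one_mul] at h
    simp only [ladderPoints, Finset.mem_filter, Finset.mem_product, Finset.mem_Icc]
    refine ⟨by omega, by simp⟩⟩

variable (k l m) in
/-- The vertices passed through on one tour around the `n`-th rectangle, starting and ending at its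
lower left corner: up the left side, along the top, down the right side, back along the bottom. -/
def rectangle (n : Fin (k + 1)) : List (LadderVertex k l m) :=
  List.ofFn (fun i : Fin m => side n.castSucc i.castSucc) ++
  List.ofFn (fun i : Fin l => top n i.castSucc) ++
  List.ofFn (fun i : Fin m => side n.succ i.rev.succ) ++
  List.ofFn (fun i : Fin l => bottom n i.rev.succ) ++
  [side n.castSucc 0]

variable (k l m)

/-- The Hilbert space of the maze digraph over the ladder graph. -/
abbrev LadderAmp : Type := Amp (ladderGraph k l m)

/-- The normalized alternating vector of the `n`-th rectangle. -/
noncomputable def cycleVector (n : Fin (k + 1)) : LadderAmp k l m :=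
  normalize (ladderGraph k l m)
    (alternating (ladderGraph k l m) (start k l m) (goal k l m) (rectangle k l m n))

variable {k l m}

/-- `γ₀, …, γ_k` are the normalized eigenvectors of the rectangles, with their signs chosen such
that `⟨γ_n, γ_{n+1}⟩ ≥ 0` and `⟨γ₀, ξ⟩ ≥ 0`. (All entries involved are real.) -/
structure IsCycleFamily (ξ : LadderAmp k l m) (γ : Fin (k + 1) → LadderAmp k l m) : Prop where
  eq_or_eq_neg : ∀ n, γ n = cycleVector k l m n ∨ γ n = - cycleVector k l m n
  inner_succ_nonneg : ∀ n : Fin k, 0 ≤ (inner ℂ (γ n.castSucc) (γ n.succ)).re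
  inner_path_nonneg : 0 ≤ (inner ℂ (γ 0) ξ).re

/-- The vectors `ψ₀, …, ψ_k, φ` obtained from `γ₀, …, γ_k, ξ` by the Gram-Schmidt process. -/
noncomputable def orthonormalized (γ : Fin (k + 1) → LadderAmp k l m) (ξ : LadderAmp k l m) :
    Fin (k + 2) → LadderAmp k l m :=
  InnerProductSpace.gramSchmidtNormed ℂ (Fin.snoc (α := fun _ => LadderAmp k l m) γ ξ)

/-- The vector `(I - Π_k) ξ`, where `Π_k = ∑_{n=0}^k |ψ_n⟩⟨ψ_n|`. -/
noncomputable def residual (γ : Fin (k + 1) → LadderAmp k l m) (ξ : LadderAmp k l m) :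
    LadderAmp k l m :=
  ξ - ∑ n : Fin (k + 1),
    inner ℂ (orthonormalized γ ξ n.castSucc) ξ • orthonormalized γ ξ n.castSucc

end ladder

/-- `κ = m / (2 (l + m))`. -/
noncomputable def kappa (l m : ℕ) : ℝ := (m : ℝ) / (2 * ((l : ℝ) + (m : ℝ)))

/-- `u_n = U_n(1 / (2 κ))`, with the Chebyshev polynomials of the second kind. -/
noncomputable def cheb (l m n : ℕ) : ℝ :=
  (Polynomial.Chebyshev.U ℝ (n : ℤ)).eval (1 / (2 * kappa l m))

end Maze

/-! If `ψ` is an eigenvector for `-1`, the vertex term `F = 2 / deg * vertexSum` of the Grover walk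
satisfies `F(o(a)) = ψ(ā) - ψ(a)`, which is odd under reversing `a`. The self-loop at the start
forces `F = 0` there, and connectedness spreads this to every vertex. So `V(-1)` consists of the
functions that agree on inverse arcs and sum to zero at each vertex (`mem_eigenspaceNegOne_iff`). At
the sink the vertex condition says that the function vanishes on the sink arc, so that part of the
definition of a navigation vector is automatic.

Alternating vectors of the rectangles are balanced because the cycles are even, and that of the path
because the self-loops absorb its ends. A balanced function that vanishes at the start loop is
determined by its values on one top edge per rectangle (`grid_eq_zero`, `balanced_eq_zero`), so the
rectangles form a basis of these functions. One more vector, nonzero at the start loop, completes a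
basis of `V(-1)`. Hence Gram-Schmidt produces a navigation vector
(`isNavigationVector_gramSchmidtNormed`), and a navigation vector spans the orthogonal complement of
the hyperplane of functions vanishing at the start loop, which gives uniqueness up to phase.

The explicit formula is a linear system. With the chosen signs the Gram matrix of the `γ` is
tridiagonal with `1` and `κ`, and `ξ` meets only `γ 0`. The recurrence `κ (u (n + 2) + u n) = u (n +
1)` makes `(-1) ^ j * u j` a null vector of the rows; its truncations, weighted by `1 / (u n * u (n
+ 1))`, telescope to a multiple of the first unit vector (`sum_sum_tridiagonal`). This identifies
the projection of `ξ`, since the residual is the only element of `ξ + span γ` orthogonal to all `γ`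
(`gramSchmidt_snoc_last_eq_of_orthogonal`). -/

namespace Maze

/-! ### Edge vectors, balanced functions and the eigenspace of `-1`. -/

section general

variable {V : Type} {G : SimpleGraph V} {s g : V}

@[simp] lemma inverse_inverse (a : MazeArc G) : inverse G (inverse G a) = a := by
  rcases a with e | _ | _ | _ | _ <;> simp [inverse]

@[simp] lemma origin_inverse (a : MazeArc G) :
    origin G s g (inverse G a) = terminal G s g a := rfl

@[simp] lemma terminal_inverse (a : MazeArc G) :
    terminal G s g (inverse G a) = origin G s g a := by
  simp [terminal]

@[simp] lemma origin_inl (e : G.Dart) : origin G s g (.inl e) = some e.fst := rfl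
@[simp] lemma origin_startLoop : origin G s g (.inr .startLoop) = some s := rfl
@[simp] lemma origin_goalLoop : origin G s g (.inr .goalLoop) = some g := rfl
@[simp] lemma origin_toSink : origin G s g (.inr .toSink) = some s := rfl
@[simp] lemma origin_fromSink : origin G s g (.inr .fromSink) = none := rfl
@[simp] lemma terminal_inl (e : G.Dart) : terminal G s g (.inl e) = some e.snd := rfl
@[simp] lemma terminal_startLoop : terminal G s g (.inr .startLoop) = some s := rfl
@[simp] lemma terminal_goalLoop : terminal G s g (.inr .goalLoop) = some g := rfl
@[simp] lemma terminal_toSink : terminal G s g (.inr .toSink) = none := rfl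
@[simp] lemma terminal_fromSink : terminal G s g (.inr .fromSink) = some s := rfl

lemma sum_extraArc (f : ExtraArc → ℂ) :
    ∑ x, f x = f .startLoop + f .goalLoop + f .toSink + f .fromSink := by
  have : (Finset.univ : Finset ExtraArc) = {.startLoop, .goalLoop, .toSink, .fromSink} := rfl
  rw [this]
  simp [add_assoc]

variable [DecidableEq V]

lemma stepVector_comm (u v : V) : stepVector G s g u v = stepVector G s g v u := by
  ext a
  simp only [stepVector, or_comm]

lemma stepVector_inl (u v : V) (e : G.Dart) :
    stepVector G s g u v (.inl e) =
      if (e.fst = u ∧ e.snd = v) ∨ (e.fst = v ∧ e.snd = u) then 1 else 0 := by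
  simp [stepVector]

lemma stepVector_startLoop (u v : V) :
    stepVector G s g u v (.inr .startLoop) = if s = u ∧ s = v then 1 else 0 := by
  simp [stepVector, and_comm]

lemma stepVector_goalLoop (u v : V) :
    stepVector G s g u v (.inr .goalLoop) = if g = u ∧ g = v then 1 else 0 := by
  simp [stepVector, and_comm]

@[simp] lemma stepVector_toSink (u v : V) : stepVector G s g u v (.inr .toSink) = 0 := by
  simp [stepVector]

@[simp] lemma stepVector_fromSink (u v : V) : stepVector G s g u v (.inr .fromSink) = 0 := by
  simp [stepVector]

lemma stepVector_inverse (u v : V) (a : MazeArc G) :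
    stepVector G s g u v (inverse G a) = stepVector G s g u v a := by
  simp only [stepVector, origin_inverse, terminal_inverse]
  congr 1
  simp only [eq_iff_iff]
  tauto

/-- The functions that agree on inverse arcs and vanish on the arcs of the sink. -/
noncomputable def edgeSpace (G : SimpleGraph V) : Submodule ℂ (Amp G) where
  carrier := {ψ | (∀ a, ψ (inverse G a) = ψ a) ∧ ψ (.inr .toSink) = 0}
  add_mem' := by
    rintro x y ⟨h1, h2⟩ ⟨h3, h4⟩
    exact ⟨fun a => by simp [h1, h3], by simp [h2, h4]⟩
  zero_mem' := ⟨fun a => by simp, by simp⟩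
  smul_mem' := by
    rintro c x ⟨h1, h2⟩
    exact ⟨fun a => by simp [h1], by simp [h2]⟩

lemma stepVector_mem_edgeSpace (u v : V) : stepVector G s g u v ∈ edgeSpace G :=
  ⟨stepVector_inverse u v, by simp⟩

variable [Fintype V] [DecidableRel G.Adj]

/-- The inner product with an edge vector adds the values on the two arcs of the edge. -/
lemma inner_stepVector_of_adj {u v : V} (h : G.Adj u v) (ψ : Amp G) :
    inner ℂ (stepVector G s g u v) ψ =
      ψ (.inl ⟨(u, v), h⟩) + ψ (.inl ⟨(v, u), h.symm⟩) := by
  have huv := h.ne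
  have key : ∀ e : G.Dart, inner ℂ (stepVector G s g u v (.inl e)) (ψ (.inl e)) =
      (if e = ⟨(u, v), h⟩ then ψ (.inl e) else 0) +
        (if e = ⟨(v, u), h.symm⟩ then ψ (.inl e) else 0) := by
    rintro ⟨⟨x, y⟩, hxy⟩
    simp only [stepVector_inl, SimpleGraph.Dart.mk.injEq, Prod.mk.injEq]
    by_cases h1 : x = u ∧ y = v
    · have h2 : ¬ (x = v ∧ y = u) := fun h2 => huv (h1.1.symm.trans h2.1)
      simp [h1, huv]
    · by_cases h2 : x = v ∧ y = u
      · simp [h2, huv.symm]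
      · simp [h1, h2]
  rw [PiLp.inner_apply, Fintype.sum_sum_type, Finset.sum_congr rfl fun e _ => key e,
    Finset.sum_add_distrib, Finset.sum_ite_eq', Finset.sum_ite_eq', sum_extraArc]
  have h3 : ¬ (s = u ∧ s = v) := fun h => huv (h.1.symm.trans h.2)
  have h4 : ¬ (g = u ∧ g = v) := fun h => huv (h.1.symm.trans h.2)
  simp [stepVector_startLoop, stepVector_goalLoop, h3, h4]

/-- A dart has distinct ends and a sink arc has an end at `none`, so only the loop matches. It is a
single arc: unlike for an edge, there is no second summand. -/
lemma inner_stepVector_start (hsg : s ≠ g) (ψ : Amp G) :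
    inner ℂ (stepVector G s g s s) ψ = ψ (.inr .startLoop) := by
  have key : ∀ e : G.Dart, stepVector G s g s s (.inl e) = 0 := by
    rintro ⟨⟨x, y⟩, hxy⟩
    rw [stepVector_inl, if_neg]
    rintro (⟨rfl, h⟩ | ⟨rfl, h⟩) <;> exact hxy.ne h.symm
  rw [PiLp.inner_apply, Fintype.sum_sum_type, sum_extraArc]
  simp [key, stepVector_startLoop, stepVector_goalLoop, hsg.symm]

lemma inner_stepVector_goal (hsg : s ≠ g) (ψ : Amp G) :
    inner ℂ (stepVector G s g g g) ψ = ψ (.inr .goalLoop) := by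
  have key : ∀ e : G.Dart, stepVector G s g g g (.inl e) = 0 := by
    rintro ⟨⟨x, y⟩, hxy⟩
    rw [stepVector_inl, if_neg]
    rintro (⟨rfl, h⟩ | ⟨rfl, h⟩) <;> exact hxy.ne h.symm
  rw [PiLp.inner_apply, Fintype.sum_sum_type, sum_extraArc]
  simp [key, stepVector_startLoop, stepVector_goalLoop, hsg]

lemma inner_stepVector_self {u v : V} (h : G.Adj u v) :
    inner ℂ (stepVector G s g u v) (stepVector G s g u v) = 2 := by
  rw [inner_stepVector_of_adj h, stepVector_inl, stepVector_inl]
  norm_num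

lemma inner_stepVector_eq_zero {u v : V} (h : G.Adj u v) {w z : V}
    (h1 : ¬ (u = w ∧ v = z)) (h2 : ¬ (u = z ∧ v = w)) :
    inner ℂ (stepVector G s g u v) (stepVector G s g w z) = 0 := by
  have h3 : ¬ (v = w ∧ u = z) := fun h => h2 h.symm
  have h4 : ¬ (v = z ∧ u = w) := fun h => h1 h.symm
  rw [inner_stepVector_of_adj h, stepVector_inl, stepVector_inl]
  simp [h1, h2, h3, h4]

/-- The sum of the values on the arcs that end at a vertex. -/
noncomputable def vertexSum (s g : V) (v : Option V) : Amp G →ₗ[ℂ] ℂ where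
  toFun ψ := ∑ b ∈ Finset.univ.filter (fun b : MazeArc G => terminal G s g b = v), ψ b
  map_add' x y := by simp [Finset.sum_add_distrib]
  map_smul' c x := by simp [Finset.mul_sum]

lemma vertexSum_apply (v : Option V) (ψ : Amp G) : vertexSum s g v ψ =
    ∑ b ∈ Finset.univ.filter (fun b : MazeArc G => terminal G s g b = v), ψ b := rfl

lemma vertexSum_none (ψ : Amp G) : vertexSum s g none ψ = ψ (.inr .toSink) := by
  rw [vertexSum_apply, Finset.sum_filter, Fintype.sum_sum_type, sum_extraArc]
  simp

lemma vertexSum_some (v : V) (ψ : Amp G) : vertexSum s g (some v) ψ =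
    (∑ e : G.Dart, if e.snd = v then ψ (.inl e) else 0) +
      (if s = v then ψ (.inr .startLoop) else 0) + (if g = v then ψ (.inr .goalLoop) else 0) +
      (if s = v then ψ (.inr .fromSink) else 0) := by
  rw [vertexSum_apply, Finset.sum_filter, Fintype.sum_sum_type, sum_extraArc]
  simp [add_assoc]

/-- Functions that agree on inverse arcs and sum to zero at each vertex. -/
def IsBalanced (s g : V) (ψ : Amp G) : Prop :=
  (∀ a, ψ (inverse G a) = ψ a) ∧ ∀ v, vertexSum s g v ψ = 0

/-- If the coefficient is zero, it is the quotient by a zero degree; then no arc ends at `v` and the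
sum is empty. -/
lemma deg_mul_eq_zero {v : Option V} {ψ : Amp G}
    (h : 2 / (deg G s g v : ℂ) * vertexSum s g v ψ = 0) : vertexSum s g v ψ = 0 := by
  rcases mul_eq_zero.1 h with h | h
  · have h0 : deg G s g v = 0 := by simpa using h
    rw [deg, Finset.card_eq_zero] at h0
    rw [vertexSum_apply, h0, Finset.sum_empty]
  · exact h

/-- Over a connected graph the eigenspace for `-1` consists of the balanced functions. -/
lemma mem_eigenspaceNegOne_iff (hG : G.Preconnected) (ψ : Amp G) :
    ψ ∈ eigenspaceNegOne G s g ↔ IsBalanced s g ψ := by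
  rw [Module.End.mem_eigenspace_iff]
  have happ : ∀ a, grover G s g ψ a = - ψ (inverse G a) +
      2 / (deg G s g (origin G s g a) : ℂ) * vertexSum s g (origin G s g a) ψ := fun a => rfl
  constructor
  · intro h
    set F : Option V → ℂ := fun v => 2 / (deg G s g v : ℂ) * vertexSum s g v ψ with hF
    have h1 : ∀ a, F (origin G s g a) = ψ (inverse G a) - ψ a := by
      intro a
      have h2 := happ a
      rw [h] at h2
      simp only [neg_smul, one_smul, PiLp.neg_apply] at h2
      simp only [hF]
      linear_combination -h2
    have hflip : ∀ a, F (terminal G s g a) = - F (origin G s g a) := by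
      intro a
      have h2 := h1 (inverse G a)
      rw [inverse_inverse, origin_inverse] at h2
      rw [h2, h1]
      ring
    -- A self-loop is its own inverse, so the difference vanishes here. Oddness alone would still
    -- allow an `F` that alternates in sign along the edges.
    have hs : F (some s) = 0 := by
      have := h1 (.inr .startLoop)
      simpa [inverse] using this
    have hwalk : ∀ {u v : V}, G.Walk u v → F (some u) = 0 → F (some v) = 0 := by
      intro u v p
      induction p with
      | nil => exact id
      | cons hadj p ih =>
        intro hu
        apply ih
        have := hflip (.inl ⟨(_, _), hadj⟩)
        simp only [terminal_inl, origin_inl] at this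
        rw [this, hu, neg_zero]
    have hall : ∀ v, F v = 0 := by
      rintro (_ | v)
      · have := hflip (.inr .toSink)
        simpa [hs] using this
      · obtain ⟨p⟩ := hG s v
        exact hwalk p hs
    refine ⟨fun a => ?_, fun v => deg_mul_eq_zero (hall v)⟩
    have := h1 a
    rw [hall] at this
    linear_combination -this
  · rintro ⟨h1, h2⟩
    ext a
    rw [happ, h1, h2]
    simp

lemma IsBalanced.apply_toSink {ψ : Amp G} (h : IsBalanced s g ψ) : ψ (.inr .toSink) = 0 := by
  rw [← vertexSum_none (s := s) (g := g)]
  exact h.2 none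

lemma IsBalanced.apply_fromSink {ψ : Amp G} (h : IsBalanced s g ψ) : ψ (.inr .fromSink) = 0 := by
  rw [← h.apply_toSink]
  exact h.1 (.inr .toSink)

/-- A balanced function, as seen by an edge vector. -/
lemma IsBalanced.inner_stepVector {ψ : Amp G} (hψ : IsBalanced s g ψ) {u v : V}
    (h : G.Adj u v) : inner ℂ (stepVector G s g u v) ψ = 2 * ψ (.inl ⟨(u, v), h⟩) := by
  rw [inner_stepVector_of_adj h, two_mul]
  congr 1
  exact hψ.1 (.inl ⟨(u, v), h⟩)

lemma vertexSum_stepVector {u v : V} (h : G.Adj u v) (x : V) :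
    vertexSum s g (some x) (stepVector G s g u v) =
      (if u = x then 1 else 0) + (if v = x then 1 else 0) := by
  have huv := h.ne
  have key : ∀ e : G.Dart, (if e.snd = x then stepVector G s g u v (.inl e) else 0) =
      (if e = ⟨(u, v), h⟩ then (if v = x then 1 else 0) else 0) +
        (if e = ⟨(v, u), h.symm⟩ then (if u = x then 1 else 0) else 0) := by
    rintro ⟨⟨y, z⟩, hyz⟩
    simp only [stepVector_inl, SimpleGraph.Dart.mk.injEq, Prod.mk.injEq]
    by_cases h1 : y = u ∧ z = v
    · have h2 : ¬ (y = v ∧ z = u) := fun h2 => huv (h1.1.symm.trans h2.1)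
      simp [h1, huv]
    · by_cases h2 : y = v ∧ z = u
      · simp [h2, huv.symm]
      · simp [h1, h2]
  have h3 : ¬ (s = u ∧ s = v) := fun h => huv (h.1.symm.trans h.2)
  have h4 : ¬ (g = u ∧ g = v) := fun h => huv (h.1.symm.trans h.2)
  rw [vertexSum_some, Finset.sum_congr rfl fun e _ => key e,
    Finset.sum_add_distrib, Finset.sum_ite_eq', Finset.sum_ite_eq']
  simp [stepVector_startLoop, stepVector_goalLoop, h3, h4, add_comm]

lemma vertexSum_stepVector_start (hsg : s ≠ g) (x : V) :
    vertexSum s g (some x) (stepVector G s g s s) = if s = x then 1 else 0 := by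
  have key : ∀ e : G.Dart, stepVector G s g s s (.inl e) = 0 := by
    rintro ⟨⟨x, y⟩, hxy⟩
    rw [stepVector_inl, if_neg]
    rintro (⟨rfl, h⟩ | ⟨rfl, h⟩) <;> exact hxy.ne h.symm
  rw [vertexSum_some]
  simp [key, stepVector_startLoop, stepVector_goalLoop, hsg.symm]

lemma vertexSum_stepVector_goal (hsg : s ≠ g) (x : V) :
    vertexSum s g (some x) (stepVector G s g g g) = if g = x then 1 else 0 := by
  have key : ∀ e : G.Dart, stepVector G s g g g (.inl e) = 0 := by
    rintro ⟨⟨x, y⟩, hxy⟩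
    rw [stepVector_inl, if_neg]
    rintro (⟨rfl, h⟩ | ⟨rfl, h⟩) <;> exact hxy.ne h.symm
  rw [vertexSum_some]
  simp [key, stepVector_startLoop, stepVector_goalLoop, hsg]

lemma isBalanced_of_mem_edgeSpace {ψ : Amp G} (h : ψ ∈ edgeSpace G)
    (h' : ∀ x : V, vertexSum s g (some x) ψ = 0) : IsBalanced s g ψ :=
  ⟨h.1, fun v => by
    cases v with
    | none => rw [vertexSum_none]; exact h.2
    | some x => exact h' x⟩

end general

/-! ### Alternating vectors along sequences of vertices. -/

section line

variable {V : Type} {G : SimpleGraph V} {s g : V}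

lemma exists_walk_support_eq_ofFn {n : ℕ} (f : Fin (n + 1) → V)
    (hf : ∀ i : Fin n, G.Adj (f i.castSucc) (f i.succ)) :
    ∃ p : G.Walk (f 0) (f (Fin.last n)), p.support = List.ofFn f := by
  induction n with
  | zero => exact ⟨SimpleGraph.Walk.nil, by simp⟩
  | succ n ih =>
    obtain ⟨p, hp⟩ := ih (fun i => f i.succ) fun i => hf i.succ
    have h0 : G.Adj (f 0) (f (Fin.succ 0)) := hf 0
    refine ⟨SimpleGraph.Walk.cons h0 p, ?_⟩
    rw [SimpleGraph.Walk.support_cons, hp, List.ofFn_succ (f := f)]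

lemma head?_ofFn_castSucc_append {n : ℕ} (hn : 1 ≤ n) (f : Fin (n + 1) → V) (L : List V) :
    (List.ofFn (fun i : Fin n => f i.castSucc) ++ L).head? = some (f 0) := by
  cases n with
  | zero => omega
  | succ n => rw [List.ofFn_succ]; rfl

variable [DecidableEq V]

/-- The alternating sum of the edge vectors along a sequence of vertices. -/
noncomputable def lineVector (G : SimpleGraph V) (s g : V) {n : ℕ} (f : Fin (n + 1) → V) :
    Amp G :=
  ∑ i : Fin n, (-1 : ℂ) ^ (i : ℕ) • stepVector G s g (f i.castSucc) (f i.succ)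

lemma lineVector_mem_edgeSpace {n : ℕ} (f : Fin (n + 1) → V) :
    lineVector G s g f ∈ edgeSpace G :=
  Submodule.sum_mem _ fun _ _ => Submodule.smul_mem _ _ (stepVector_mem_edgeSpace _ _)

lemma lineVector_succ {n : ℕ} (f : Fin (n + 2) → V) :
    lineVector G s g f =
      stepVector G s g (f 0) (f (Fin.succ 0)) - lineVector G s g (fun i => f i.succ) := by
  rw [lineVector, lineVector, Fin.sum_univ_succ]
  simp only [Fin.val_zero, pow_zero, one_smul, Fin.val_succ, pow_succ, mul_neg, mul_one,
    neg_smul, Finset.sum_neg_distrib, Fin.castSucc_zero, Fin.succ_castSucc]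
  abel

/-- The last vertex of `f` is left to the head of `L`, so that pieces can be glued at a corner
without listing it twice. The sign is the parity of the `n` edges already passed. -/
lemma alternating_ofFn_append {n : ℕ} (f : Fin (n + 1) → V) (L : List V)
    (hL : L.head? = some (f (Fin.last n))) :
    alternating G s g (List.ofFn (fun i : Fin n => f i.castSucc) ++ L) =
      lineVector G s g f + (-1 : ℂ) ^ n • alternating G s g L := by
  induction n with
  | zero => simp [lineVector]
  | succ n ih =>
    have ih' := ih (fun i => f i.succ) (by simpa using hL)
    rw [List.ofFn_succ, List.cons_append]
    -- `alternating` unfolds only when two vertices are visible; the second one comes from `L` if `n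
    -- = 0` and from `f` otherwise.
    obtain ⟨w, L', hw, hwf⟩ : ∃ w L', List.ofFn (fun i : Fin n => f i.succ.castSucc) ++ L =
        w :: L' ∧ w = f (Fin.succ 0) := by
      cases n with
      | zero =>
        cases L with
        | nil => simp at hL
        | cons w L' => exact ⟨w, L', by simp, by simpa using hL⟩
      | succ n =>
        exact ⟨f (Fin.succ 0), List.ofFn (fun i : Fin n => f i.succ.succ.castSucc) ++ L,
          by rw [List.ofFn_succ, List.cons_append]; rfl, rfl⟩
    have ih2 : alternating G s g (w :: L') = _ := hw ▸ ih'
    rw [hw, alternating, ih2, lineVector_succ, hwf, pow_succ, mul_neg, mul_one, neg_smul,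
      Fin.castSucc_zero]
    abel

/-- The edge in position `i` moves to position `n - 1 - i`, which changes its sign by `(-1) ^ (n -
1)`. Writing this as `-(-1) ^ n` avoids truncated subtraction. -/
lemma lineVector_rev {n : ℕ} (f : Fin (n + 1) → V) :
    lineVector G s g (fun i => f i.rev) = (-(-1 : ℂ) ^ n) • lineVector G s g f := by
  rw [lineVector, lineVector, Finset.smul_sum, ← Equiv.sum_comp Fin.revPerm]
  refine Finset.sum_congr rfl fun i _ => ?_
  rw [smul_smul, Fin.revPerm_apply, Fin.rev_castSucc, Fin.rev_succ, Fin.rev_rev, stepVector_comm]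
  congr 1
  have h : ((i.rev : Fin n) : ℕ) + (i + 1) = n := by rw [Fin.val_rev]; omega
  have h2 : ((-1 : ℂ) ^ (i : ℕ)) * (-1) ^ (i : ℕ) = 1 := by rw [← mul_pow]; simp
  calc (-1 : ℂ) ^ (i.rev : ℕ) = -((-1 : ℂ) ^ ((i.rev : ℕ) + (i + 1)) * (-1) ^ (i : ℕ)) := by
        rw [pow_add, pow_succ]
        linear_combination (-(-1 : ℂ) ^ (i.rev : ℕ)) * h2
    _ = _ := by rw [h]; ring

variable [Fintype V] [DecidableRel G.Adj]

/-- Consecutive edges have opposite signs and cancel at the vertex between them, so only the two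
ends contribute. -/
lemma vertexSum_lineVector {n : ℕ} (f : Fin (n + 1) → V)
    (hf : ∀ i : Fin n, G.Adj (f i.castSucc) (f i.succ)) (x : V) :
    vertexSum s g (some x) (lineVector G s g f) =
      (if f 0 = x then 1 else 0) - (-1) ^ n * (if f (Fin.last n) = x then 1 else 0) := by
  induction n with
  | zero => simp [lineVector]
  | succ n ih =>
    have h0 : G.Adj (f 0) (f (Fin.succ 0)) := hf 0
    rw [lineVector_succ, map_sub, ih _ fun i => hf i.succ, vertexSum_stepVector h0,
      Fin.succ_last, pow_succ]
    ring

lemma inner_lineVector_eq_zero {n : ℕ} {f : Fin (n + 1) → V} {ψ : Amp G}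
    (h : ∀ i : Fin n, inner ℂ (stepVector G s g (f i.castSucc) (f i.succ)) ψ = 0) :
    inner ℂ (lineVector G s g f) ψ = 0 := by
  rw [lineVector, sum_inner]
  exact Finset.sum_eq_zero fun i _ => by rw [inner_smul_left, h, mul_zero]

lemma inner_lineVector_right_eq_zero {n : ℕ} {f : Fin (n + 1) → V} {ψ : Amp G}
    (h : ∀ i : Fin n, inner ℂ ψ (stepVector G s g (f i.castSucc) (f i.succ)) = 0) :
    inner ℂ ψ (lineVector G s g f) = 0 := by
  rw [lineVector, inner_sum]
  exact Finset.sum_eq_zero fun i _ => by rw [inner_smul_right, h, mul_zero]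

lemma inner_stepVector_lineVector {n : ℕ} {f : Fin (n + 1) → V}
    (hf : ∀ i : Fin n, G.Adj (f i.castSucc) (f i.succ)) (hinj : Function.Injective f)
    (i : Fin n) :
    inner ℂ (stepVector G s g (f i.castSucc) (f i.succ)) (lineVector G s g f) =
      2 * (-1) ^ (i : ℕ) := by
  rw [lineVector, inner_sum, Finset.sum_eq_single i, inner_smul_right,
    inner_stepVector_self (hf i), mul_comm]
  · intro j _ hj
    rw [inner_smul_right, inner_stepVector_eq_zero (hf i), mul_zero]
    · rintro ⟨h, -⟩
      exact hj (Fin.castSucc_injective _ (hinj h)).symm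
    · rintro ⟨h1, h2⟩
      have h1 := congrArg Fin.val (hinj h1)
      have h2 := congrArg Fin.val (hinj h2)
      simp only [Fin.val_castSucc, Fin.val_succ] at h1 h2
      omega
  · simp

lemma inner_lineVector_self {n : ℕ} {f : Fin (n + 1) → V}
    (hf : ∀ i : Fin n, G.Adj (f i.castSucc) (f i.succ)) (hinj : Function.Injective f) :
    inner ℂ (lineVector G s g f) (lineVector G s g f) = 2 * n := by
  have key : ∀ i : Fin n, inner ℂ ((-1 : ℂ) ^ (i : ℕ) •
      stepVector G s g (f i.castSucc) (f i.succ)) (lineVector G s g f) = 2 := by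
    intro i
    have h2 : ((-1 : ℂ) ^ (i : ℕ)) * (-1) ^ (i : ℕ) = 1 := by rw [← mul_pow]; simp
    rw [inner_smul_left, inner_stepVector_lineVector hf hinj, map_pow, map_neg, map_one]
    linear_combination 2 * h2
  calc _ = ∑ i : Fin n, inner ℂ ((-1 : ℂ) ^ (i : ℕ) •
      stepVector G s g (f i.castSucc) (f i.succ)) (lineVector G s g f) := sum_inner ..
    _ = _ := by simp [key, mul_comm]

end line

/-! ### Sides of the rectangles and their inner products. -/

section ladder

variable {k l m : ℕ}

lemma mem_ladderPoints {q : ℤ × ℤ} : q ∈ ladderPoints k l m ↔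
    (0 ≤ q.1 ∧ q.1 ≤ ((k : ℤ) + 1) * l) ∧ (-1 ≤ q.2 ∧ q.2 ≤ (m : ℤ) + 1) ∧
      (q.1 = 0 ∨ q.2 = 0 ∨ q.2 = (m : ℤ) ∨ ((l : ℤ) ∣ q.1 ∧ 0 ≤ q.2 ∧ q.2 ≤ (m : ℤ))) := by
  simp only [ladderPoints, Finset.mem_filter, Finset.mem_product, Finset.mem_Icc]
  push_cast
  tauto

lemma ladderGraph_adj {p q : LadderVertex k l m} : (ladderGraph k l m).Adj p q ↔
    (p.1.1 = q.1.1 ∧ (l : ℤ) ∣ p.1.1 ∧ (q.1.2 = p.1.2 + 1 ∨ p.1.2 = q.1.2 + 1)) ∨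
    (p.1.2 = q.1.2 ∧ (p.1.2 = 0 ∨ p.1.2 = (m : ℤ)) ∧
      (q.1.1 = p.1.1 + 1 ∨ p.1.1 = q.1.1 + 1)) := Iff.rfl

lemma start_ne_goal : start k l m ≠ goal k l m := by
  intro h
  have := congrArg (fun v : LadderVertex k l m => v.1.2) h
  simp only [start, goal] at this
  omega

lemma adj_side (j : Fin (k + 2)) (i : Fin m) :
    (ladderGraph k l m).Adj (side j i.castSucc) (side j i.succ) := by
  rw [ladderGraph_adj]
  refine Or.inl ⟨rfl, ?_, Or.inl ?_⟩ <;> simp [side]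

lemma adj_top (n : Fin (k + 1)) (i : Fin l) :
    (ladderGraph k l m).Adj (top n i.castSucc) (top n i.succ) := by
  rw [ladderGraph_adj]
  refine Or.inr ⟨rfl, Or.inr rfl, Or.inl ?_⟩
  simp [top, add_assoc]

lemma adj_bottom (n : Fin (k + 1)) (i : Fin l) :
    (ladderGraph k l m).Adj (bottom n i.castSucc) (bottom n i.succ) := by
  rw [ladderGraph_adj]
  refine Or.inr ⟨rfl, Or.inl rfl, Or.inl ?_⟩
  simp [bottom, add_assoc]

lemma adj_start : (ladderGraph k l m).Adj (start k l m) (side 0 0) := by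
  rw [ladderGraph_adj]
  refine Or.inl ⟨?_, ?_, Or.inl ?_⟩ <;> simp [side, start]

lemma adj_goal : (ladderGraph k l m).Adj (side 0 (Fin.last m)) (goal k l m) := by
  rw [ladderGraph_adj]
  refine Or.inl ⟨?_, ?_, Or.inl ?_⟩ <;> simp [side, goal]

lemma side_injective (j : Fin (k + 2)) :
    Function.Injective (side j : Fin (m + 1) → LadderVertex k l m) := by
  intro a b h
  have := congrArg (fun v : LadderVertex k l m => v.1.2) h
  simp only [side] at this
  omega

lemma top_injective (n : Fin (k + 1)) :
    Function.Injective (top n : Fin (l + 1) → LadderVertex k l m) := by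
  intro a b h
  have := congrArg (fun v : LadderVertex k l m => v.1.1) h
  simp only [top] at this
  omega

lemma bottom_injective (n : Fin (k + 1)) :
    Function.Injective (bottom n : Fin (l + 1) → LadderVertex k l m) := by
  intro a b h
  have := congrArg (fun v : LadderVertex k l m => v.1.1) h
  simp only [bottom] at this
  omega

/-- This and the next three lemmas identify the corners: there the sides are glued into a cycle, and
there their vertex sums cancel. -/
lemma top_zero (n : Fin (k + 1)) :
    (top n 0 : LadderVertex k l m) = side n.castSucc (Fin.last m) := by
  simp [top, side]

lemma top_last (n : Fin (k + 1)) :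
    (top n (Fin.last l) : LadderVertex k l m) = side n.succ (Fin.last m) := by
  simp [top, side, add_mul]

lemma bottom_zero (n : Fin (k + 1)) :
    (bottom n 0 : LadderVertex k l m) = side n.castSucc 0 := by
  simp [bottom, side]

lemma bottom_last (n : Fin (k + 1)) :
    (bottom n (Fin.last l) : LadderVertex k l m) = side n.succ 0 := by
  simp [bottom, side, add_mul]

variable (k l m) in
/-- The alternating vector of the `j`-th vertical side. -/
noncomputable abbrev sideVector (j : Fin (k + 2)) : LadderAmp k l m :=
  lineVector (ladderGraph k l m) (start k l m) (goal k l m) (side j)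

variable (k l m) in
/-- The alternating vector of the top side of the `n`-th rectangle. -/
noncomputable abbrev topVector (n : Fin (k + 1)) : LadderAmp k l m :=
  lineVector (ladderGraph k l m) (start k l m) (goal k l m) (top n)

variable (k l m) in
/-- The alternating vector of the bottom side of the `n`-th rectangle. -/
noncomputable abbrev bottomVector (n : Fin (k + 1)) : LadderAmp k l m :=
  lineVector (ladderGraph k l m) (start k l m) (goal k l m) (bottom n)

variable (k l m) in
/-- The edge vectors of the ladder. -/
noncomputable abbrev edge (u v : LadderVertex k l m) : LadderAmp k l m :=
  stepVector (ladderGraph k l m) (start k l m) (goal k l m) u v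

/-- Passing to coordinates turns the disjointness of two edges into integer arithmetic. -/
lemma edge_orthogonal {u v w z : LadderVertex k l m} (h : (ladderGraph k l m).Adj u v)
    (h1 : ¬ (u.1 = w.1 ∧ v.1 = z.1)) (h2 : ¬ (u.1 = z.1 ∧ v.1 = w.1)) :
    inner ℂ (edge k l m u v) (edge k l m w z) = 0 :=
  inner_stepVector_eq_zero h
    (fun e => h1 ⟨congrArg Subtype.val e.1, congrArg Subtype.val e.2⟩)
    (fun e => h2 ⟨congrArg Subtype.val e.1, congrArg Subtype.val e.2⟩)

lemma inner_side_side (hl : 1 ≤ l) (i j : Fin (k + 2)) :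
    inner ℂ (sideVector k l m i) (sideVector k l m j) = if i = j then 2 * (m : ℂ) else 0 := by
  split_ifs with h
  · subst h
    exact inner_lineVector_self (adj_side i) (side_injective i)
  · refine inner_lineVector_eq_zero fun a => inner_lineVector_right_eq_zero fun b =>
      edge_orthogonal (adj_side i a) ?_ ?_ <;>
    · simp only [side, Prod.mk.injEq, Nat.cast_inj]
      rintro ⟨⟨h1, -⟩, -⟩
      exact h (Fin.ext (Nat.eq_of_mul_eq_mul_right hl h1))

lemma inner_side_edge_top (j : Fin (k + 2)) (n : Fin (k + 1)) (i : Fin l) :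
    inner ℂ (sideVector k l m j) (edge k l m (top n i.castSucc) (top n i.succ)) = 0 := by
  refine inner_lineVector_eq_zero fun a => edge_orthogonal (adj_side j a) ?_ ?_ <;>
  · simp only [side, top, Prod.mk.injEq, Nat.cast_inj, Fin.val_castSucc, Fin.val_succ]
    omega

lemma inner_side_top (j : Fin (k + 2)) (n : Fin (k + 1)) :
    inner ℂ (sideVector k l m j) (topVector k l m n) = 0 :=
  inner_lineVector_right_eq_zero fun i => inner_side_edge_top j n i

lemma inner_side_bottom (j : Fin (k + 2)) (n : Fin (k + 1)) :
    inner ℂ (sideVector k l m j) (bottomVector k l m n) = 0 := by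
  refine inner_lineVector_eq_zero fun a => inner_lineVector_right_eq_zero fun b =>
      edge_orthogonal (adj_side j a) ?_ ?_ <;>
  · simp only [side, bottom, Prod.mk.injEq, Nat.cast_inj, Fin.val_castSucc, Fin.val_succ]
    omega

/-- The lines at heights `0` and `m` are different because `m` is positive. -/
lemma inner_bottom_edge_top (hm : 1 ≤ m) (n n' : Fin (k + 1)) (i : Fin l) :
    inner ℂ (bottomVector k l m n) (edge k l m (top n' i.castSucc) (top n' i.succ)) = 0 := by
  refine inner_lineVector_eq_zero fun a => edge_orthogonal (adj_bottom n a) ?_ ?_ <;>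
  · simp only [top, bottom, Prod.mk.injEq]
    omega

lemma inner_bottom_top (hm : 1 ≤ m) (n n' : Fin (k + 1)) :
    inner ℂ (bottomVector k l m n) (topVector k l m n') = 0 :=
  inner_lineVector_right_eq_zero fun i => inner_bottom_edge_top hm n n' i

/-- Division by `l` recovers the rectangle from the left end of a horizontal edge; this separates
the horizontal edges of different rectangles. -/
lemma eq_of_mul_add_eq {a b x y : ℕ} (hx : x < l) (hy : y < l) (h : a * l + x = b * l + y) :
    a = b := by
  have h1 : (a * l + x) / l = a := by
    rw [mul_comm, Nat.mul_add_div (by omega), Nat.div_eq_of_lt hx, add_zero]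
  have h2 : (b * l + y) / l = b := by
    rw [mul_comm, Nat.mul_add_div (by omega), Nat.div_eq_of_lt hy, add_zero]
  rw [← h1, h, h2]

lemma inner_top_edge_top_of_ne {n n' : Fin (k + 1)} (h : n ≠ n') (i : Fin l) :
    inner ℂ (topVector k l m n) (edge k l m (top n' i.castSucc) (top n' i.succ)) = 0 := by
  refine inner_lineVector_eq_zero fun a => edge_orthogonal (adj_top n a) ?_ ?_
  · simp only [top, Prod.mk.injEq, Nat.cast_inj]
    rintro ⟨⟨h1, -⟩, -⟩
    exact h (Fin.ext (eq_of_mul_add_eq a.2 i.2 h1))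
  · simp only [top, Prod.mk.injEq, Nat.cast_inj, Fin.val_castSucc, Fin.val_succ]
    omega

lemma inner_top_top (n n' : Fin (k + 1)) :
    inner ℂ (topVector k l m n) (topVector k l m n') = if n = n' then 2 * (l : ℂ) else 0 := by
  split_ifs with h
  · subst h
    exact inner_lineVector_self (adj_top n) (top_injective n)
  · exact inner_lineVector_right_eq_zero fun i => inner_top_edge_top_of_ne h i

lemma inner_bottom_bottom (n n' : Fin (k + 1)) :
    inner ℂ (bottomVector k l m n) (bottomVector k l m n') =
      if n = n' then 2 * (l : ℂ) else 0 := by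
  split_ifs with h
  · subst h
    exact inner_lineVector_self (adj_bottom n) (bottom_injective n)
  · refine inner_lineVector_eq_zero fun a => inner_lineVector_right_eq_zero fun i =>
      edge_orthogonal (adj_bottom n a) ?_ ?_
    · simp only [bottom, Prod.mk.injEq, Nat.cast_inj]
      rintro ⟨⟨h1, -⟩, -⟩
      exact h (Fin.ext (eq_of_mul_add_eq a.2 i.2 h1))
    · simp only [bottom, Prod.mk.injEq, Nat.cast_inj, Fin.val_castSucc, Fin.val_succ]
      omega

lemma inner_side_edge_start (j : Fin (k + 2)) :
    inner ℂ (sideVector k l m j) (edge k l m (start k l m) (side 0 0)) = 0 := by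
  refine inner_lineVector_eq_zero fun a => edge_orthogonal (adj_side j a) ?_ ?_ <;>
  · simp only [side, start, Prod.mk.injEq]
    omega

lemma inner_side_edge_goal (j : Fin (k + 2)) :
    inner ℂ (sideVector k l m j) (edge k l m (side 0 (Fin.last m)) (goal k l m)) = 0 := by
  refine inner_lineVector_eq_zero fun a => edge_orthogonal (adj_side j a) ?_ ?_ <;>
  · simp only [side, goal, Prod.mk.injEq]
    omega

/-- The edge at the start changes height, whereas `f` stays at height `y`. One lemma thus serves the
top and the bottom line. -/
lemma inner_horizontal_edge_start {f : Fin (l + 1) → LadderVertex k l m} (y : ℤ)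
    (hf : ∀ i : Fin l, (ladderGraph k l m).Adj (f i.castSucc) (f i.succ))
    (hy : ∀ i, (f i).1.2 = y) :
    inner ℂ (lineVector (ladderGraph k l m) (start k l m) (goal k l m) f)
      (edge k l m (start k l m) (side 0 0)) = 0 := by
  refine inner_lineVector_eq_zero fun a => edge_orthogonal (hf a) ?_ ?_ <;>
  · rintro ⟨h1, h2⟩
    have h1 := congrArg Prod.snd h1
    have h2 := congrArg Prod.snd h2
    rw [hy] at h1 h2
    simp only [side, start, Fin.val_zero] at h1 h2
    omega

lemma inner_horizontal_edge_goal {f : Fin (l + 1) → LadderVertex k l m} (y : ℤ)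
    (hf : ∀ i : Fin l, (ladderGraph k l m).Adj (f i.castSucc) (f i.succ))
    (hy : ∀ i, (f i).1.2 = y) :
    inner ℂ (lineVector (ladderGraph k l m) (start k l m) (goal k l m) f)
      (edge k l m (side 0 (Fin.last m)) (goal k l m)) = 0 := by
  refine inner_lineVector_eq_zero fun a => edge_orthogonal (hf a) ?_ ?_ <;>
  · rintro ⟨h1, h2⟩
    have h1 := congrArg Prod.snd h1
    have h2 := congrArg Prod.snd h2
    rw [hy] at h1 h2
    simp only [side, goal, Fin.val_last] at h1 h2
    omega

lemma lineVector_startLoop {n : ℕ} {f : Fin (n + 1) → LadderVertex k l m}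
    (hf : ∀ i : Fin n, (ladderGraph k l m).Adj (f i.castSucc) (f i.succ)) :
    lineVector (ladderGraph k l m) (start k l m) (goal k l m) f (.inr .startLoop) = 0 := by
  rw [← inner_stepVector_start start_ne_goal]
  refine inner_lineVector_right_eq_zero fun i => ?_
  rw [inner_stepVector_start start_ne_goal, stepVector_startLoop, if_neg]
  rintro ⟨h1, h2⟩
  exact (hf i).ne (h1.symm.trans h2)

lemma lineVector_goalLoop {n : ℕ} {f : Fin (n + 1) → LadderVertex k l m}
    (hf : ∀ i : Fin n, (ladderGraph k l m).Adj (f i.castSucc) (f i.succ)) :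
    lineVector (ladderGraph k l m) (start k l m) (goal k l m) f (.inr .goalLoop) = 0 := by
  rw [← inner_stepVector_goal start_ne_goal]
  refine inner_lineVector_right_eq_zero fun i => ?_
  rw [inner_stepVector_goal start_ne_goal, stepVector_goalLoop, if_neg]
  rintro ⟨h1, h2⟩
  exact (hf i).ne (h1.symm.trans h2)

/-- The tour runs through the right and the bottom side backwards, after `m + l` and `2 * m + l`
edges. Together with the reversal signs `-(-1) ^ m` and `-(-1) ^ l` this leaves the coefficients
`-(-1) ^ l` and `-1`. -/
lemma alternating_rectangle (hl : 1 ≤ l) (hm : 1 ≤ m) (n : Fin (k + 1)) :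
    alternating (ladderGraph k l m) (start k l m) (goal k l m) (rectangle k l m n) =
      sideVector k l m n.castSucc + (-1 : ℂ) ^ m • topVector k l m n -
        (-1 : ℂ) ^ l • sideVector k l m n.succ - bottomVector k l m n := by
  have h1 := fun L => alternating_ofFn_append (G := ladderGraph k l m) (s := start k l m)
    (g := goal k l m) (fun a : Fin (m + 1) => (side n.succ a.rev : LadderVertex k l m)) L
  have h2 := fun L => alternating_ofFn_append (G := ladderGraph k l m) (s := start k l m)
    (g := goal k l m) (fun a : Fin (l + 1) => (bottom n a.rev : LadderVertex k l m)) L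
  simp only [Fin.rev_castSucc] at h1 h2
  have e1 : (-1 : ℂ) ^ m * (-1) ^ m = 1 := by rw [← mul_pow]; simp
  have e2 : (-1 : ℂ) ^ l * (-1) ^ l = 1 := by rw [← mul_pow]; simp
  simp only [rectangle, List.append_assoc]
  rw [alternating_ofFn_append, alternating_ofFn_append, h1, h2, lineVector_rev, lineVector_rev]
  · simp only [alternating, smul_zero, add_zero, smul_add, smul_smul]
    have e3 : (-1 : ℂ) ^ m * ((-1) ^ l * -(-1) ^ m) = -(-1) ^ l := by
      linear_combination (-(-1 : ℂ) ^ l) * e1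
    have e4 : (-1 : ℂ) ^ m * ((-1) ^ l * ((-1) ^ m * -(-1) ^ l)) = -1 := by
      linear_combination (-(-1 : ℂ) ^ l * (-1) ^ l) * e1 - e2
    rw [e3, e4]
    module
  · simp [bottom_zero]
  · have h3 := head?_ofFn_castSucc_append hl
      (fun a : Fin (l + 1) => (bottom n a.rev : LadderVertex k l m))
    simp only [Fin.rev_castSucc] at h3
    rw [h3]
    simp [bottom_last]
  · have h3 := head?_ofFn_castSucc_append hm
      (fun a : Fin (m + 1) => (side n.succ a.rev : LadderVertex k l m))
    simp only [Fin.rev_castSucc] at h3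
    rw [h3]
    simp [top_last]
  · rw [head?_ofFn_castSucc_append hl]
    simp [top_zero]

end ladder

/-! ### Rectangles and the left path: balance and inner products. -/

section ladder

variable {k l m : ℕ}

variable (k l m) in
/-- The alternating vector of the `n`-th rectangle before normalization. -/
noncomputable abbrev rectangleVector (n : Fin (k + 1)) : LadderAmp k l m :=
  alternating (ladderGraph k l m) (start k l m) (goal k l m) (rectangle k l m n)

lemma inner_side_rectangle (hl : 1 ≤ l) (hm : 1 ≤ m) (j : Fin (k + 2)) (n : Fin (k + 1)) :
    inner ℂ (sideVector k l m j) (rectangleVector k l m n) =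
      2 * (m : ℂ) * ((if j = n.castSucc then 1 else 0) -
        (-1) ^ l * (if j = n.succ then 1 else 0)) := by
  rw [rectangleVector, alternating_rectangle hl hm, inner_sub_right, inner_sub_right,
    inner_add_right, inner_smul_right, inner_smul_right, inner_side_side hl, inner_side_side hl,
    inner_side_top, inner_side_bottom]
  split_ifs <;> ring

lemma inner_top_rectangle (hl : 1 ≤ l) (hm : 1 ≤ m) (n n' : Fin (k + 1)) :
    inner ℂ (topVector k l m n) (rectangleVector k l m n') =
      (-1) ^ m * (2 * (l : ℂ) * (if n = n' then 1 else 0)) := by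
  rw [rectangleVector, alternating_rectangle hl hm, inner_sub_right, inner_sub_right,
    inner_add_right, inner_smul_right, inner_smul_right, inner_top_top,
    inner_eq_zero_symm.1 (inner_side_top _ _), inner_eq_zero_symm.1 (inner_side_top _ _),
    inner_eq_zero_symm.1 (inner_bottom_top hm _ _)]
  split_ifs <;> ring

lemma inner_bottom_rectangle (hl : 1 ≤ l) (hm : 1 ≤ m) (n n' : Fin (k + 1)) :
    inner ℂ (bottomVector k l m n) (rectangleVector k l m n') =
      -(2 * (l : ℂ) * (if n = n' then 1 else 0)) := by
  rw [rectangleVector, alternating_rectangle hl hm, inner_sub_right, inner_sub_right,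
    inner_add_right, inner_smul_right, inner_smul_right, inner_bottom_bottom,
    inner_eq_zero_symm.1 (inner_side_bottom _ _), inner_eq_zero_symm.1 (inner_side_bottom _ _),
    inner_bottom_top hm]
  split_ifs <;> ring

lemma inner_rectangle_left (hl : 1 ≤ l) (hm : 1 ≤ m) (n : Fin (k + 1)) (ψ : LadderAmp k l m) :
    inner ℂ (rectangleVector k l m n) ψ =
      inner ℂ (sideVector k l m n.castSucc) ψ + (-1) ^ m * inner ℂ (topVector k l m n) ψ -
        (-1) ^ l * inner ℂ (sideVector k l m n.succ) ψ - inner ℂ (bottomVector k l m n) ψ := by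
  rw [rectangleVector, alternating_rectangle hl hm, inner_sub_left, inner_sub_left,
    inner_add_left, inner_smul_left, inner_smul_left]
  simp

/-- Neighbours share one vertical side, which has coefficient `-(-1) ^ l` as the right side of one
and `1` as the left side of the other, and squared norm `2 * m`. On the diagonal each of the `2 * (l
+ m)` edges counts for two arcs. -/
lemma inner_rectangle_rectangle (hl : 1 ≤ l) (hm : 1 ≤ m) (n n' : Fin (k + 1)) :
    inner ℂ (rectangleVector k l m n) (rectangleVector k l m n') =
      4 * ((l : ℂ) + m) * (if n = n' then 1 else 0) - 2 * m * (-1) ^ l *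
        ((if n.castSucc = n'.succ then 1 else 0) + (if n.succ = n'.castSucc then 1 else 0)) := by
  have e1 : (-1 : ℂ) ^ m * (-1) ^ m = 1 := by rw [← mul_pow]; simp
  have e2 : (-1 : ℂ) ^ l * (-1) ^ l = 1 := by rw [← mul_pow]; simp
  rw [inner_rectangle_left hl hm, inner_side_rectangle hl hm, inner_side_rectangle hl hm,
    inner_top_rectangle hl hm, inner_bottom_rectangle hl hm]
  simp only [Fin.castSucc_inj, Fin.succ_inj]
  linear_combination (2 * (l : ℂ) * (if n = n' then 1 else 0)) * e1 +
    (2 * (m : ℂ) * (if n = n' then 1 else 0)) * e2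

/-- A rectangle as seen by the first edge of the top side of a rectangle. -/
lemma inner_top_edge_rectangle (hl : 1 ≤ l) (hm : 1 ≤ m) (n n' : Fin (k + 1)) :
    inner ℂ (edge k l m (top n (Fin.castSucc ⟨0, hl⟩)) (top n (Fin.succ ⟨0, hl⟩)))
      (rectangleVector k l m n') = 2 * (-1) ^ m * (if n = n' then 1 else 0) := by
  rw [rectangleVector, alternating_rectangle hl hm, inner_sub_right, inner_sub_right,
    inner_add_right, inner_smul_right, inner_smul_right,
    inner_eq_zero_symm.1 (inner_side_edge_top _ _ _),
    inner_eq_zero_symm.1 (inner_side_edge_top _ _ _),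
    inner_eq_zero_symm.1 (inner_bottom_edge_top hm _ _ _)]
  split_ifs with h
  · subst h
    rw [topVector, edge, inner_stepVector_lineVector (adj_top n) (top_injective n)]
    simp
    ring
  · rw [inner_eq_zero_symm.1 (inner_top_edge_top_of_ne (Ne.symm h) _)]
    simp

lemma rectangle_mem_edgeSpace (hl : 1 ≤ l) (hm : 1 ≤ m) (n : Fin (k + 1)) :
    rectangleVector k l m n ∈ edgeSpace (ladderGraph k l m) := by
  rw [rectangleVector, alternating_rectangle hl hm]
  exact Submodule.sub_mem _ (Submodule.sub_mem _ (Submodule.add_mem _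
    (lineVector_mem_edgeSpace _) (Submodule.smul_mem _ _ (lineVector_mem_edgeSpace _)))
    (Submodule.smul_mem _ _ (lineVector_mem_edgeSpace _))) (lineVector_mem_edgeSpace _)

/-- Each side contributes only at its ends, and at each corner the two contributions cancel, because
the cycle has even length. -/
lemma isBalanced_rectangle (hl : 1 ≤ l) (hm : 1 ≤ m) (n : Fin (k + 1)) :
    IsBalanced (start k l m) (goal k l m) (rectangleVector k l m n) := by
  refine isBalanced_of_mem_edgeSpace (rectangle_mem_edgeSpace hl hm n) fun x => ?_
  rw [rectangleVector, alternating_rectangle hl hm, map_sub, map_sub, map_add, map_smul, map_smul,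
    vertexSum_lineVector _ (adj_side _), vertexSum_lineVector _ (adj_side _),
    vertexSum_lineVector _ (adj_top _), vertexSum_lineVector _ (adj_bottom _),
    top_zero, top_last, bottom_zero, bottom_last, smul_eq_mul, smul_eq_mul]
  ring

lemma rectangle_startLoop (hl : 1 ≤ l) (hm : 1 ≤ m) (n : Fin (k + 1)) :
    rectangleVector k l m n (.inr .startLoop) = 0 := by
  rw [rectangleVector, alternating_rectangle hl hm]
  simp [lineVector_startLoop (adj_side _), lineVector_startLoop (adj_top _),
    lineVector_startLoop (adj_bottom _)]

variable (k l m) in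
/-- The alternating vector of the path along the left side before normalization. -/
noncomputable def leftPathVector : LadderAmp k l m :=
  edge k l m (start k l m) (start k l m) - edge k l m (start k l m) (side 0 0) +
    sideVector k l m 0 + (-1 : ℂ) ^ m • edge k l m (side 0 (Fin.last m)) (goal k l m) -
    (-1 : ℂ) ^ m • edge k l m (goal k l m) (goal k l m)

/-- At either end of the path the self-loop supplies the one arc that cancels the single edge there.
-/
lemma isBalanced_leftPath : IsBalanced (start k l m) (goal k l m) (leftPathVector k l m) := by
  refine isBalanced_of_mem_edgeSpace ?_ fun x => ?_
  · exact Submodule.sub_mem _ (Submodule.add_mem _ (Submodule.add_mem _ (Submodule.sub_mem _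
      (stepVector_mem_edgeSpace _ _) (stepVector_mem_edgeSpace _ _)) (lineVector_mem_edgeSpace _))
      (Submodule.smul_mem _ _ (stepVector_mem_edgeSpace _ _)))
      (Submodule.smul_mem _ _ (stepVector_mem_edgeSpace _ _))
  · rw [leftPathVector, map_sub, map_add, map_add, map_sub, map_smul, map_smul,
      vertexSum_stepVector adj_start, vertexSum_stepVector adj_goal,
      vertexSum_lineVector _ (adj_side _), vertexSum_stepVector_start start_ne_goal,
      vertexSum_stepVector_goal start_ne_goal, smul_eq_mul, smul_eq_mul]
    ring

lemma leftPath_startLoop : leftPathVector k l m (.inr .startLoop) = 1 := by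
  have h1 := (adj_start (k := k) (l := l) (m := m)).ne
  have h2 := start_ne_goal (k := k) (l := l) (m := m)
  simp [leftPathVector, lineVector_startLoop (adj_side _), stepVector_startLoop, h1, h2]

lemma leftPath_goalLoop : leftPathVector k l m (.inr .goalLoop) = -(-1) ^ m := by
  have h1 := (adj_goal (k := k) (l := l) (m := m)).ne
  have h2 := start_ne_goal (k := k) (l := l) (m := m)
  simp [leftPathVector, lineVector_goalLoop (adj_side _), stepVector_goalLoop, h1.symm, h2.symm]

lemma inner_lineVector_edge_start {n : ℕ} {f : Fin (n + 1) → LadderVertex k l m}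
    (hf : ∀ i : Fin n, (ladderGraph k l m).Adj (f i.castSucc) (f i.succ)) :
    inner ℂ (lineVector (ladderGraph k l m) (start k l m) (goal k l m) f)
      (edge k l m (start k l m) (start k l m)) = 0 := by
  rw [inner_eq_zero_symm, inner_stepVector_start start_ne_goal, lineVector_startLoop hf]

lemma inner_lineVector_edge_goal {n : ℕ} {f : Fin (n + 1) → LadderVertex k l m}
    (hf : ∀ i : Fin n, (ladderGraph k l m).Adj (f i.castSucc) (f i.succ)) :
    inner ℂ (lineVector (ladderGraph k l m) (start k l m) (goal k l m) f)
      (edge k l m (goal k l m) (goal k l m)) = 0 := by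
  rw [inner_eq_zero_symm, inner_stepVector_goal start_ne_goal, lineVector_goalLoop hf]

lemma inner_side_leftPath (hl : 1 ≤ l) (j : Fin (k + 2)) :
    inner ℂ (sideVector k l m j) (leftPathVector k l m) = if j = 0 then 2 * (m : ℂ) else 0 := by
  rw [leftPathVector, inner_sub_right, inner_add_right, inner_add_right, inner_sub_right,
    inner_smul_right, inner_smul_right, inner_side_side hl, inner_side_edge_start,
    inner_side_edge_goal, inner_lineVector_edge_start (adj_side _),
    inner_lineVector_edge_goal (adj_side _)]
  simp

lemma inner_horizontal_leftPath {f : Fin (l + 1) → LadderVertex k l m} (y : ℤ)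
    (hf : ∀ i : Fin l, (ladderGraph k l m).Adj (f i.castSucc) (f i.succ))
    (hy : ∀ i, (f i).1.2 = y)
    (hs : inner ℂ (lineVector (ladderGraph k l m) (start k l m) (goal k l m) f)
      (sideVector k l m 0) = 0) :
    inner ℂ (lineVector (ladderGraph k l m) (start k l m) (goal k l m) f)
      (leftPathVector k l m) = 0 := by
  rw [leftPathVector, inner_sub_right, inner_add_right, inner_add_right, inner_sub_right,
    inner_smul_right, inner_smul_right, hs, inner_horizontal_edge_start y hf hy,
    inner_horizontal_edge_goal y hf hy, inner_lineVector_edge_start hf,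
    inner_lineVector_edge_goal hf]
  simp

/-- The path meets only the left side of the `0`-th rectangle, and both vectors contain that side
with coefficient `1`. -/
lemma inner_rectangle_leftPath (hl : 1 ≤ l) (hm : 1 ≤ m) (n : Fin (k + 1)) :
    inner ℂ (rectangleVector k l m n) (leftPathVector k l m) =
      if n = 0 then 2 * (m : ℂ) else 0 := by
  rw [inner_rectangle_left hl hm, inner_side_leftPath hl, inner_side_leftPath hl,
    inner_horizontal_leftPath m (adj_top n) (fun _ => rfl)
      (inner_eq_zero_symm.1 (inner_side_top _ _)),
    inner_horizontal_leftPath 0 (adj_bottom n) (fun _ => rfl)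
      (inner_eq_zero_symm.1 (inner_side_bottom _ _)), if_neg (Fin.succ_ne_zero n)]
  simp

/-- There are `m + 2` edges with two arcs each and two loops with one arc each. -/
lemma inner_leftPath_leftPath (hl : 1 ≤ l) :
    inner ℂ (leftPathVector k l m) (leftPathVector k l m) = 2 * ((m : ℂ) + 3) := by
  have e1 : (-1 : ℂ) ^ m * (-1) ^ m = 1 := by rw [← mul_pow]; simp
  have hcoord : ∀ i : Fin (m + 1), (side 0 i : LadderVertex k l m).1 = (0, (i : ℤ)) := by
    intro i
    simp [side]
  have h1 : inner ℂ (edge k l m (start k l m) (side 0 0)) (leftPathVector k l m) = -2 := by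
    rw [leftPathVector, inner_sub_right, inner_add_right, inner_add_right, inner_sub_right,
      inner_smul_right, inner_smul_right, inner_stepVector_self adj_start,
      inner_eq_zero_symm.1 (inner_side_edge_start 0), edge_orthogonal adj_start,
      edge_orthogonal adj_start, edge_orthogonal adj_start]
    · ring
    all_goals
      simp only [hcoord, start, goal, Prod.mk.injEq, Fin.val_zero, Fin.val_last]
      omega
  have h2 : inner ℂ (edge k l m (side 0 (Fin.last m)) (goal k l m)) (leftPathVector k l m) =
      2 * (-1) ^ m := by
    rw [leftPathVector, inner_sub_right, inner_add_right, inner_add_right, inner_sub_right,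
      inner_smul_right, inner_smul_right, inner_stepVector_self adj_goal,
      inner_eq_zero_symm.1 (inner_side_edge_goal 0), edge_orthogonal adj_goal,
      edge_orthogonal adj_goal, edge_orthogonal adj_goal]
    · ring
    all_goals
      simp only [hcoord, start, goal, Prod.mk.injEq, Fin.val_zero, Fin.val_last]
      omega
  have expand : ∀ ψ : LadderAmp k l m, inner ℂ (leftPathVector k l m) ψ =
      inner ℂ (edge k l m (start k l m) (start k l m)) ψ -
        inner ℂ (edge k l m (start k l m) (side 0 0)) ψ + inner ℂ (sideVector k l m 0) ψ +
        (-1) ^ m * inner ℂ (edge k l m (side 0 (Fin.last m)) (goal k l m)) ψ -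
        (-1) ^ m * inner ℂ (edge k l m (goal k l m) (goal k l m)) ψ := by
    intro ψ
    rw [leftPathVector, inner_sub_left, inner_add_left, inner_add_left, inner_sub_left,
      inner_smul_left, inner_smul_left]
    simp
  rw [expand, h1, h2, inner_side_leftPath hl, if_pos rfl, inner_stepVector_start start_ne_goal,
    inner_stepVector_goal start_ne_goal, leftPath_startLoop, leftPath_goalLoop]
  linear_combination 3 * e1

end ladder

/-! ### The shortest path, connectedness, and the sweep over the grid. -/

section ladder

variable {k l m : ℕ}

/-- A step raises the height by at most one. Applied from start to goal, this bounds the distance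
from below by `m + 2`. -/
lemma sub_le_length {u v : LadderVertex k l m} (p : (ladderGraph k l m).Walk u v) :
    v.1.2 - u.1.2 ≤ p.length := by
  induction p with
  | nil => simp
  | cons h p ih =>
    rw [ladderGraph_adj] at h
    rw [SimpleGraph.Walk.length_cons]
    push_cast
    omega

/-- A walk that goes up at each step is determined by its ends. -/
lemma walk_eq_of_length_eq_sub {u v : LadderVertex k l m} (p q : (ladderGraph k l m).Walk u v)
    (hp : (p.length : ℤ) = v.1.2 - u.1.2) (hq : (q.length : ℤ) = v.1.2 - u.1.2) : p = q := by
  induction p with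
  | nil =>
    cases q with
    | nil => rfl
    | cons h q => simp at hq; omega
  | cons h p ih =>
    cases q with
    | nil => simp at hp; omega
    | cons h' q =>
      rename_i w _ w'
      have h1 := sub_le_length p
      have h2 := sub_le_length q
      rw [SimpleGraph.Walk.length_cons] at hp hq
      push_cast at hp hq
      -- The remaining walk cannot climb more than its length, so the first step must go up, and an
      -- upward step keeps the abscissa.
      have hw : w = w' := by
        rw [ladderGraph_adj] at h h'
        exact Subtype.ext (Prod.ext (by omega) (by omega))
      subst hw
      rw [ladderGraph_adj] at h h'
      rw [ih q (by omega) (by omega)]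

lemma exists_leftPath : ∃ p : (ladderGraph k l m).Walk (start k l m) (goal k l m),
    p.support = start k l m :: (List.ofFn (side 0) ++ [goal k l m]) := by
  obtain ⟨p, hp⟩ := exists_walk_support_eq_ofFn (side 0) (adj_side (k := k) (l := l) (m := m) 0)
  refine ⟨SimpleGraph.Walk.cons adj_start (p.concat adj_goal), ?_⟩
  rw [SimpleGraph.Walk.support_cons, SimpleGraph.Walk.support_concat, hp]

lemma length_leftPath {p : (ladderGraph k l m).Walk (start k l m) (goal k l m)}
    (hp : p.support = start k l m :: (List.ofFn (side 0) ++ [goal k l m])) :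
    p.length = m + 2 := by
  have := congrArg List.length hp
  rw [SimpleGraph.Walk.length_support] at this
  simpa using this

lemma dist_start_goal : (ladderGraph k l m).dist (start k l m) (goal k l m) = m + 2 := by
  obtain ⟨p, hp⟩ := exists_leftPath (k := k) (l := l) (m := m)
  have h1 := SimpleGraph.dist_le p
  rw [length_leftPath hp] at h1
  obtain ⟨q, hq⟩ := p.reachable.exists_walk_length_eq_dist
  have h2 := sub_le_length q
  simp only [start, goal] at h2 hq h1
  simp only [start, goal]
  omega

lemma eq_of_length_eq_dist {p q : (ladderGraph k l m).Walk (start k l m) (goal k l m)}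
    (hp : p.length = (ladderGraph k l m).dist (start k l m) (goal k l m))
    (hq : q.length = (ladderGraph k l m).dist (start k l m) (goal k l m)) : p = q := by
  rw [dist_start_goal] at hp hq
  apply walk_eq_of_length_eq_sub
  · rw [hp]; simp only [start, goal]; push_cast; ring
  · rw [hq]; simp only [start, goal]; push_cast; ring

lemma existsUnique_shortest :
    ∃! p : (ladderGraph k l m).Walk (start k l m) (goal k l m),
      p.length = (ladderGraph k l m).dist (start k l m) (goal k l m) := by
  obtain ⟨p, hp⟩ := exists_leftPath (k := k) (l := l) (m := m)
  have h : p.length = (ladderGraph k l m).dist (start k l m) (goal k l m) := by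
    rw [length_leftPath hp, dist_start_goal]
  exact ⟨p, h, fun q hq => eq_of_length_eq_dist hq h⟩

lemma alternating_shortest {p : (ladderGraph k l m).Walk (start k l m) (goal k l m)}
    (hp : p.length = (ladderGraph k l m).dist (start k l m) (goal k l m)) :
    alternating (ladderGraph k l m) (start k l m) (goal k l m)
      (start k l m :: (p.support ++ [goal k l m])) = leftPathVector k l m := by
  obtain ⟨q, hq⟩ := exists_leftPath (k := k) (l := l) (m := m)
  obtain rfl : p = q := eq_of_length_eq_dist hp (by rw [length_leftPath hq, dist_start_goal])
  have h1 : (List.ofFn (side 0) ++ [goal k l m]) ++ [goal k l m] =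
      List.ofFn (fun i : Fin m => side 0 i.castSucc) ++
        [side 0 (Fin.last m), goal k l m, goal k l m] := by
    rw [List.ofFn_succ']
    simp
  -- The lower left corner must be visible as head before the first two edges of `alternating` can
  -- be split off.
  have h2 : ∃ L, List.ofFn (fun i : Fin m => side 0 i.castSucc) ++
        [side 0 (Fin.last m), goal k l m, goal k l m] = side 0 0 :: L := by
    cases m with
    | zero => exact ⟨_, rfl⟩
    | succ m => exact ⟨_, by rw [List.ofFn_succ]; rfl⟩
  obtain ⟨L, hL⟩ := h2
  have h3 := alternating_ofFn_append (G := ladderGraph k l m) (s := start k l m)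
    (g := goal k l m) (side 0) [side 0 (Fin.last m), goal k l m, goal k l m] rfl
  rw [hL] at h3
  rw [hq, List.cons_append, h1, hL, alternating, alternating, h3, leftPathVector]
  simp only [alternating]
  module

lemma reachable_of_pos {x y : ℤ} (hx : 0 ≤ x) (hy : y = 0 ∨ y = m)
    (hxy : (x, y) ∈ ladderPoints k l m) (h0 : (0, y) ∈ ladderPoints k l m) :
    (ladderGraph k l m).Reachable ⟨(0, y), h0⟩ ⟨(x, y), hxy⟩ := by
  induction x, hx using Int.leInduction with
  | base => exact SimpleGraph.Reachable.refl _
  | succ x hx ih =>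
    have hxy' : (x, y) ∈ ladderPoints k l m := by
      rw [mem_ladderPoints] at hxy ⊢
      simp only at hxy ⊢
      exact ⟨⟨hx, by linarith [hxy.1.2]⟩, hxy.2.1, by tauto⟩
    refine (ih hxy').trans (SimpleGraph.Adj.reachable ?_)
    rw [ladderGraph_adj]
    exact Or.inr ⟨rfl, hy, Or.inl rfl⟩

lemma reachable_of_dvd {x y : ℤ} (hx : (l : ℤ) ∣ x) (hy : 0 ≤ y) (hym : y ≤ m)
    (hxy : (x, y) ∈ ladderPoints k l m) (h0 : (x, 0) ∈ ladderPoints k l m) :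
    (ladderGraph k l m).Reachable ⟨(x, 0), h0⟩ ⟨(x, y), hxy⟩ := by
  induction y, hy using Int.leInduction with
  | base => exact SimpleGraph.Reachable.refl _
  | succ y hy ih =>
    have hxy' : (x, y) ∈ ladderPoints k l m := by
      rw [mem_ladderPoints] at hxy ⊢
      simp only at hxy ⊢
      exact ⟨hxy.1, by omega, Or.inr (Or.inr (Or.inr ⟨hx, hy, by omega⟩))⟩
    refine (ih (by omega) hxy').trans (SimpleGraph.Adj.reachable ?_)
    rw [ladderGraph_adj]
    exact Or.inl ⟨rfl, hx, Or.inl rfl⟩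

/-- Points on a vertical side are reached along the bottom line and then upwards, points of the top
line by way of the left side. -/
lemma reachable_start (v : LadderVertex k l m) :
    (ladderGraph k l m).Reachable (start k l m) v := by
  obtain ⟨⟨x, y⟩, hv⟩ := v
  have hv' := mem_ladderPoints.1 hv
  simp only at hv'
  obtain ⟨hx, hy, hor⟩ := hv'
  have hb : ∀ x : ℤ, 0 ≤ x → x ≤ ((k : ℤ) + 1) * l → (x, 0) ∈ ladderPoints k l m := by
    intro x hx hx'
    rw [mem_ladderPoints]
    exact ⟨⟨hx, hx'⟩, by constructor <;> simp only <;> omega, Or.inr (Or.inl rfl)⟩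
  have h00 := hb 0 le_rfl (by positivity)
  have h1 : (ladderGraph k l m).Reachable (start k l m) ⟨(0, 0), h00⟩ :=
    SimpleGraph.Adj.reachable (Or.inl ⟨rfl, dvd_zero _, Or.inl rfl⟩)
  have hcol : ∀ (hxl : (l : ℤ) ∣ x), 0 ≤ y → y ≤ m →
      (ladderGraph k l m).Reachable (start k l m) ⟨(x, y), hv⟩ := fun hxl h2 h3 =>
    (h1.trans (reachable_of_pos hx.1 (Or.inl rfl) (hb x hx.1 hx.2) h00)).trans
      (reachable_of_dvd hxl h2 h3 hv (hb x hx.1 hx.2))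
  have h0m : (0, (m : ℤ)) ∈ ladderPoints k l m := by
    rw [mem_ladderPoints]
    exact ⟨⟨le_rfl, by positivity⟩, by constructor <;> simp only <;> omega, Or.inl rfl⟩
  have h2 : (ladderGraph k l m).Reachable (start k l m) ⟨(0, m), h0m⟩ :=
    h1.trans (reachable_of_dvd (dvd_zero _) (by omega) le_rfl h0m h00)
  rcases hor with rfl | rfl | rfl | ⟨hxl, h3, h4⟩
  · rcases lt_trichotomy y (-1) with h | rfl | h
    · omega
    · exact SimpleGraph.Reachable.refl _
    · by_cases hym : y = m + 1
      · subst hym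
        exact h2.trans (SimpleGraph.Adj.reachable (Or.inl ⟨rfl, dvd_zero _, Or.inl rfl⟩))
      · exact hcol (dvd_zero _) (by omega) (by omega)
  · exact h1.trans (reachable_of_pos hx.1 (Or.inl rfl) hv h00)
  · exact h2.trans (reachable_of_pos hx.1 (Or.inr rfl) hv h0m)
  · exact hcol hxl h3 h4

lemma ladderGraph_preconnected : (ladderGraph k l m).Preconnected :=
  fun u v => (reachable_start u).symm.trans (reachable_start v)

/-- Edge values on the ladder that sum to zero at all points but the goal, and that vanish on
the first top edge of each rectangle, vanish. -/
lemma grid_eq_zero (hl : 1 ≤ l) (hm : 1 ≤ m) {H W : ℤ → ℤ → ℂ}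
    (hH : ∀ x y, H x y ≠ 0 → 0 ≤ x ∧ x + 1 ≤ ((k : ℤ) + 1) * l ∧ (y = 0 ∨ y = m))
    (hW : ∀ x y, W x y ≠ 0 → (l : ℤ) ∣ x ∧ 0 ≤ x ∧ x ≤ ((k : ℤ) + 1) * l ∧
      (-1 ≤ y ∧ y ≤ m) ∧ (x = 0 ∨ (0 ≤ y ∧ y < m)))
    (hE : ∀ x y, (x, y) ∈ ladderPoints k l m → (x, y) ≠ (0, (m : ℤ) + 1) →
      H x y + H (x - 1) y + W x y + W x (y - 1) = 0)
    (h0 : ∀ n : Fin (k + 1), H (n * l : ℕ) m = 0) :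
    (∀ x y, H x y = 0) ∧ ∀ x y, W x y = 0 := by
  have hl' : (0 : ℤ) < l := by exact_mod_cast hl
  -- `H x y` and `W x y` belong to the edges going right and up from `(x, y)`. Strictly between two
  -- vertical sides only horizontal edges meet, so the vertex equation passes zero on from the first
  -- top edge to the next ones.
  have htop' : ∀ (n : Fin (k + 1)) (i : ℕ), i < l → H ((n * l : ℕ) + i) m = 0 := by
    intro n i
    induction i with
    | zero => intro _; simpa using h0 n
    | succ i ih =>
      intro hi
      have hnd : ¬ (l : ℤ) ∣ ((n * l : ℕ) : ℤ) + (i + 1 : ℕ) := by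
        intro hd
        have := (Nat.dvd_add_right (Dvd.intro_left (n : ℕ) rfl)).1
          (by exact_mod_cast hd : l ∣ n * l + (i + 1))
        exact absurd (Nat.le_of_dvd (by omega) this) (by omega)
      have hle : ((n : ℕ) + 1) * l ≤ (k + 1) * l := Nat.mul_le_mul_right l n.2
      rw [Nat.add_mul, one_mul] at hle
      have hle' : ((n * l : ℕ) : ℤ) + l ≤ ((k : ℤ) + 1) * l := by exact_mod_cast hle
      have hw : ∀ y, W (((n * l : ℕ) : ℤ) + (i + 1 : ℕ)) y = 0 := fun y => by
        by_contra h
        exact hnd (hW _ _ h).1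
      have := hE (((n * l : ℕ) : ℤ) + (i + 1 : ℕ)) m
        (by
          rw [mem_ladderPoints]
          refine ⟨⟨by positivity, ?_⟩, ⟨?_, ?_⟩, Or.inr (Or.inr (Or.inl rfl))⟩ <;>
            simp only <;> omega)
        (by intro h; have := congrArg Prod.snd h; simp only at this; omega)
      rw [hw, hw, add_zero, add_zero] at this
      have hi' := ih (by omega)
      rw [show ((n * l : ℕ) : ℤ) + (i + 1 : ℕ) - 1 = ((n * l : ℕ) : ℤ) + i by push_cast; ring,
        hi', add_zero] at this
      exact this
  have htop : ∀ x, H x m = 0 := by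
    intro x
    by_contra h
    obtain ⟨hx0, hx1, -⟩ := hH _ _ h
    lift x to ℕ using hx0
    have hx2 : x < (k + 1) * l := by exact_mod_cast (by omega : (x : ℤ) < ((k : ℤ) + 1) * l)
    have hdiv : x / l < k + 1 := Nat.div_lt_of_lt_mul (by rwa [mul_comm] at hx2)
    have := htop' ⟨x / l, hdiv⟩ (x % l) (Nat.mod_lt _ hl)
    apply h
    rw [← this]
    congr 1
    have := Nat.div_add_mod' x l
    exact_mod_cast this.symm
  have hHy : ∀ x y, y ≠ 0 → H x y = 0 := by
    intro x y hy
    by_contra h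
    rcases (hH _ _ h).2.2 with h1 | h1
    · exact hy h1
    · subst h1
      exact h (htop x)
  -- Downwards along the columns other than the leftmost: nothing lies above height `m`, and
  -- horizontal edges off the bottom line are already zero.
  have hWx' : ∀ (x : ℤ), x ≠ 0 → ∀ d : ℕ, W x (m - d) = 0 := by
    intro x hx d
    induction d with
    | zero =>
      by_contra h
      have := (hW _ _ h).2.2.2.2
      simp at this
      omega
    | succ d ih =>
      by_contra h
      obtain ⟨h1, h2, h3, -, h5⟩ := hW _ _ h
      push_cast at h5
      have hpt : (x, (m : ℤ) - d) ∈ ladderPoints k l m := by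
        rw [mem_ladderPoints]
        refine ⟨⟨h2, h3⟩, ?_, Or.inr (Or.inr (Or.inr ⟨h1, ?_, ?_⟩))⟩ <;> simp only <;> omega
      have := hE _ _ hpt (by intro h; exact hx (congrArg Prod.fst h))
      rw [hHy _ _ (by omega), hHy _ _ (by omega), ih,
        show (m : ℤ) - d - 1 = m - (d + 1 : ℕ) by push_cast; ring] at this
      apply h
      simpa using this
  have hWx : ∀ x y, x ≠ 0 → W x y = 0 := by
    intro x y hx
    by_contra h
    have h5 := (hW _ _ h).2.2.2.1
    have := hWx' x hx (m - y).toNat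
    rw [Int.toNat_of_nonneg (by omega), sub_sub_cancel] at this
    exact h this
  -- Leftwards along the bottom line: no edge leaves its right end, and the columns met before the
  -- leftmost are zero.
  have hH0' : ∀ d : ℕ, H (((k : ℤ) + 1) * l - d) 0 = 0 := by
    intro d
    induction d with
    | zero =>
      by_contra h
      have := (hH _ _ h).2.1
      simp at this
    | succ d ih =>
      by_contra h
      obtain ⟨h1, h2, -⟩ := hH _ _ h
      push_cast at h1
      have hpt : (((k : ℤ) + 1) * l - d, (0 : ℤ)) ∈ ladderPoints k l m := by
        rw [mem_ladderPoints]
        refine ⟨⟨?_, ?_⟩, ⟨?_, ?_⟩, Or.inr (Or.inl rfl)⟩ <;> simp only <;> omega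
      have := hE _ _ hpt (by
        intro h
        have := congrArg Prod.snd h
        simp only at this
        omega)
      rw [hWx _ _ (by omega), hWx _ _ (by omega), ih,
        show ((k : ℤ) + 1) * l - d - 1 = ((k : ℤ) + 1) * l - (d + 1 : ℕ) by
          push_cast; ring] at this
      apply h
      simpa using this
  have hHall : ∀ x y, H x y = 0 := by
    intro x y
    by_cases hy : y = 0
    · subst hy
      by_contra h
      have h5 := (hH _ _ h).2.1
      have := hH0' (((k : ℤ) + 1) * l - x).toNat
      rw [Int.toNat_of_nonneg (by omega), sub_sub_cancel] at this
      exact h this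
    · exact hHy x y hy
  -- Upwards along the left column. The shift by `2` begins just below the start, outside the
  -- support of `W`; the support ends at height `m`, so the equation at the goal is never needed.
  have hW0' : ∀ d : ℕ, W 0 ((d : ℤ) - 2) = 0 := by
    intro d
    induction d with
    | zero =>
      by_contra h
      have := (hW _ _ h).2.2.2.1
      simp at this
    | succ d ih =>
      by_contra h
      obtain ⟨-, h2, h3, h4, -⟩ := hW _ _ h
      have hpt : ((0 : ℤ), ((d + 1 : ℕ) : ℤ) - 2) ∈ ladderPoints k l m := by
        rw [mem_ladderPoints]
        refine ⟨⟨h2, h3⟩, ⟨?_, ?_⟩, Or.inl rfl⟩ <;> simp only <;> omega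
      have := hE _ _ hpt (by
        intro h
        have := congrArg Prod.snd h
        simp only at this
        omega)
      rw [hHall, hHall, show ((d + 1 : ℕ) : ℤ) - 2 - 1 = (d : ℤ) - 2 by push_cast; ring,
        ih] at this
      apply h
      simpa using this
  refine ⟨hHall, fun x y => ?_⟩
  by_cases hx : x = 0
  · subst hx
    by_contra h
    have h5 := (hW _ _ h).2.2.2.1
    have := hW0' (y + 2).toNat
    rw [Int.toNat_of_nonneg (by omega), add_sub_cancel_right] at this
    exact h this
  · exact hWx x y hx

end ladder

/-! ### From balanced functions to edge values in the plane. -/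

section ladder

variable {k l m : ℕ}

/-- The value of a function on the arc between two points of the plane; zero if there is none. -/
noncomputable def arcValue (ψ : LadderAmp k l m) (P Q : ℤ × ℤ) : ℂ :=
  ∑ e : (ladderGraph k l m).Dart, if e.fst.1 = P ∧ e.snd.1 = Q then ψ (.inl e) else 0

lemma arcValue_dart (ψ : LadderAmp k l m) (e : (ladderGraph k l m).Dart) :
    arcValue ψ e.fst.1 e.snd.1 = ψ (.inl e) := by
  rw [arcValue, Finset.sum_eq_single e]
  · simp
  · intro e' _ he
    rw [if_neg]
    rintro ⟨h1, h2⟩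
    exact he (SimpleGraph.Dart.ext _ _ (Prod.ext (Subtype.ext h1) (Subtype.ext h2)))
  · simp

lemma exists_dart_of_arcValue_ne_zero {ψ : LadderAmp k l m} {P Q : ℤ × ℤ}
    (h : arcValue ψ P Q ≠ 0) : ∃ e : (ladderGraph k l m).Dart, e.fst.1 = P ∧ e.snd.1 = Q := by
  by_contra! hne
  exact h (Finset.sum_eq_zero fun e _ => if_neg fun h => hne e h.1 h.2)

lemma arcValue_comm {ψ : LadderAmp k l m} (hψ : IsBalanced (start k l m) (goal k l m) ψ)
    (P Q : ℤ × ℤ) : arcValue ψ P Q = arcValue ψ Q P := by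
  by_cases h : ∃ e : (ladderGraph k l m).Dart, e.fst.1 = P ∧ e.snd.1 = Q
  · obtain ⟨e, rfl, rfl⟩ := h
    have h2 := arcValue_dart ψ e.symm
    rw [arcValue_dart]
    change arcValue ψ e.snd.1 e.fst.1 = _ at h2
    rw [h2]
    exact (hψ.1 (.inl e)).symm
  · by_contra hne
    have h1 : arcValue ψ P Q = 0 := by
      by_contra h1
      exact h (exists_dart_of_arcValue_ne_zero h1)
    have h2 : arcValue ψ Q P = 0 := by
      by_contra h2
      obtain ⟨e, h3, h4⟩ := exists_dart_of_arcValue_ne_zero h2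
      exact h ⟨e.symm, h4, h3⟩
    exact hne (h1.trans h2.symm)

/-- The arcs of the ladder that end at a point come from its four neighbours. -/
lemma sum_dart_eq (ψ : LadderAmp k l m) (v : LadderVertex k l m) :
    (∑ e : (ladderGraph k l m).Dart, if e.snd = v then ψ (.inl e) else 0) =
      arcValue ψ (v.1.1 + 1, v.1.2) v.1 + arcValue ψ (v.1.1 - 1, v.1.2) v.1 +
        arcValue ψ (v.1.1, v.1.2 + 1) v.1 + arcValue ψ (v.1.1, v.1.2 - 1) v.1 := by
  simp only [arcValue, ← Finset.sum_add_distrib]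
  refine Finset.sum_congr rfl fun e _ => ?_
  by_cases hv : e.snd = v
  · subst hv
    have hadj := e.adj
    rw [ladderGraph_adj] at hadj
    simp only [and_true, if_true, Prod.ext_iff]
    rcases hadj with ⟨h1, -, h2 | h2⟩ | ⟨h1, -, h2 | h2⟩
    · rw [if_neg (by omega), if_neg (by omega), if_neg (by omega), if_pos (by omega)]; simp
    · rw [if_neg (by omega), if_neg (by omega), if_pos (by omega), if_neg (by omega)]; simp
    · rw [if_neg (by omega), if_pos (by omega), if_neg (by omega), if_neg (by omega)]; simp
    · rw [if_pos (by omega), if_neg (by omega), if_neg (by omega), if_neg (by omega)]; simp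
  · have hv' : e.snd.1 ≠ v.1 := fun h => hv (Subtype.ext h)
    simp [hv, hv']

/-- A balanced function that vanishes on the self-loop at the start and on one top edge of each
rectangle vanishes. -/
lemma balanced_eq_zero (hl : 1 ≤ l) (hm : 1 ≤ m) {ψ : LadderAmp k l m}
    (hψ : IsBalanced (start k l m) (goal k l m) ψ) (hs : ψ (.inr .startLoop) = 0)
    (h0 : ∀ n : Fin (k + 1), inner ℂ
      (edge k l m (top n (Fin.castSucc ⟨0, hl⟩)) (top n (Fin.succ ⟨0, hl⟩))) ψ = 0) :
    ψ = 0 := by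
  -- By symmetry every edge may be read in the rightward or upward direction, the form used for the
  -- sweep. Of the extra arcs only the goal loop remains.
  have hsum : ∀ v : LadderVertex k l m, arcValue ψ v.1 (v.1.1 + 1, v.1.2) +
      arcValue ψ (v.1.1 - 1, v.1.2) v.1 + arcValue ψ v.1 (v.1.1, v.1.2 + 1) +
      arcValue ψ (v.1.1, v.1.2 - 1) v.1 +
      (if goal k l m = v then ψ (.inr .goalLoop) else 0) = 0 := by
    intro v
    have := hψ.2 (some v)
    rw [vertexSum_some, sum_dart_eq, hs, hψ.apply_fromSink, ite_self, add_zero,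
      add_zero, arcValue_comm hψ (_ + 1, _), arcValue_comm hψ (_, _ + 1)] at this
    exact this
  obtain ⟨hH, hW⟩ := grid_eq_zero (k := k) (l := l) (m := m) hl hm
    (H := fun x y => arcValue ψ (x, y) (x + 1, y)) (W := fun x y => arcValue ψ (x, y) (x, y + 1))
    (by
      intro x y h
      obtain ⟨e, h1, h2⟩ := exists_dart_of_arcValue_ne_zero h
      have hadj := e.adj
      have h3 := mem_ladderPoints.1 e.fst.2
      have h4 := mem_ladderPoints.1 e.snd.2
      rw [ladderGraph_adj] at hadj
      rw [h1, h2] at hadj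
      rw [h1] at h3
      rw [h2] at h4
      simp only at hadj h3 h4
      exact ⟨h3.1.1, h4.1.2, by omega⟩)
    (by
      intro x y h
      obtain ⟨e, h1, h2⟩ := exists_dart_of_arcValue_ne_zero h
      have hadj := e.adj
      have h3 := mem_ladderPoints.1 e.fst.2
      have h4 := mem_ladderPoints.1 e.snd.2
      rw [ladderGraph_adj] at hadj
      rw [h1, h2] at hadj
      rw [h1] at h3
      rw [h2] at h4
      simp only at hadj h3 h4
      refine ⟨by omega, h3.1.1, h3.1.2, by omega, by omega⟩)
    (by
      intro x y hxy hne
      have := hsum ⟨(x, y), hxy⟩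
      rw [if_neg (fun h => hne (congrArg Subtype.val h).symm), add_zero] at this
      simpa using this)
    (by
      intro n
      have h1 := h0 n
      rw [hψ.inner_stepVector (adj_top n _), ← arcValue_dart] at h1
      simpa [top, add_assoc] using h1)
  -- With all edges zero, the balance at the goal contains only its loop.
  have hgoal : ψ (.inr .goalLoop) = 0 := by
    have := hsum (goal k l m)
    have h1 := hH (goal k l m).1.1 (goal k l m).1.2
    have h2 := hW (goal k l m).1.1 (goal k l m).1.2
    have h3 := hH ((goal k l m).1.1 - 1) (goal k l m).1.2
    have h4 := hW (goal k l m).1.1 ((goal k l m).1.2 - 1)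
    rw [sub_add_cancel] at h3 h4
    rw [h1, h2, h3, h4] at this
    simpa using this
  ext a
  rcases a with e | _ | _ | _ | _
  · rw [← arcValue_dart]
    have hadj := e.adj
    rw [ladderGraph_adj] at hadj
    have hP : ∀ P Q : ℤ × ℤ, (P.1 = Q.1 ∧ (Q.2 = P.2 + 1 ∨ P.2 = Q.2 + 1)) ∨
        (P.2 = Q.2 ∧ (Q.1 = P.1 + 1 ∨ P.1 = Q.1 + 1)) → arcValue ψ P Q = 0 := by
      rintro ⟨x, y⟩ ⟨x', y'⟩ (⟨h1, h2 | h2⟩ | ⟨h1, h2 | h2⟩) <;> simp only at h1 h2 <;> subst h1 h2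
      · exact hW _ _
      · rw [arcValue_comm hψ]; exact hW _ _
      · exact hH _ _
      · rw [arcValue_comm hψ]; exact hH _ _
    exact hP _ _ (by tauto)
  · exact hs
  · exact hgoal
  · exact hψ.apply_toSink
  · exact hψ.apply_fromSink

end ladder

end Maze

/-! ### The last vector of the Gram-Schmidt process. -/

section gramSchmidt

open InnerProductSpace

lemma Fin.snoc_image_Iio_last {E : Type*} {k : ℕ} (γ : Fin (k + 1) → E) (ξ : E) :
    Fin.snoc (α := fun _ => E) γ ξ '' Set.Iio (Fin.last (k + 1)) = Set.range γ := by
  ext x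
  constructor
  · rintro ⟨i, hi, rfl⟩
    obtain ⟨j, rfl⟩ := Fin.exists_castSucc_eq.2 (ne_of_lt hi)
    exact ⟨j, by simp⟩
  · rintro ⟨j, rfl⟩
    exact ⟨j.castSucc, Fin.castSucc_lt_last j, by simp⟩

variable {E : Type*} [NormedAddCommGroup E] [InnerProductSpace ℂ E] {k : ℕ}

/-- The projection onto a line does not depend on the scale of the spanning vector. A zero vector
stays zero when normalized, so no independence is required. -/
lemma gramSchmidt_snoc_last_eq (γ : Fin (k + 1) → E) (ξ : E) :
    gramSchmidt ℂ (Fin.snoc (α := fun _ => E) γ ξ) (Fin.last (k + 1)) =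
      ξ - ∑ n : Fin (k + 1),
        inner ℂ (gramSchmidtNormed ℂ (Fin.snoc (α := fun _ => E) γ ξ) n.castSucc) ξ •
          gramSchmidtNormed ℂ (Fin.snoc (α := fun _ => E) γ ξ) n.castSucc := by
  rw [gramSchmidt_def, Fin.snoc_last, Fin.Iio_last_eq_map, Finset.sum_map]
  congr 1
  refine Finset.sum_congr rfl fun n _ => ?_
  rw [Submodule.starProjection_singleton, gramSchmidtNormed, inner_smul_left, smul_smul]
  congr 1
  simp only [map_inv₀, Fin.coe_castSuccEmb]
  push_cast
  simp
  ring

lemma gramSchmidtNormed_snoc_castSucc_mem (γ : Fin (k + 1) → E) (ξ : E) (n : Fin (k + 1)) :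
    gramSchmidtNormed ℂ (Fin.snoc (α := fun _ => E) γ ξ) n.castSucc ∈
      Submodule.span ℂ (Set.range γ) := by
  rw [← Fin.snoc_image_Iio_last γ ξ, ← span_gramSchmidt_Iio, ← span_gramSchmidtNormed]
  exact Submodule.subset_span ⟨_, Fin.castSucc_lt_last n, rfl⟩

/-- The last Gram-Schmidt vector is the only translate by the span of the other vectors that is
orthogonal to them. -/
lemma gramSchmidt_snoc_last_eq_of_orthogonal {γ : Fin (k + 1) → E} {ξ r : E}
    (h1 : ξ - r ∈ Submodule.span ℂ (Set.range γ)) (h2 : ∀ i, inner ℂ (γ i) r = 0) :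
    gramSchmidt ℂ (Fin.snoc (α := fun _ => E) γ ξ) (Fin.last (k + 1)) = r := by
  set f : Fin (k + 2) → E := Fin.snoc (α := fun _ => E) γ ξ with hf
  set S := Submodule.span ℂ (Set.range γ) with hS
  have h3 : ξ - gramSchmidt ℂ f (Fin.last (k + 1)) ∈ S := by
    rw [gramSchmidt_snoc_last_eq, sub_sub_cancel]
    exact Submodule.sum_mem _ fun n _ =>
      Submodule.smul_mem _ _ (gramSchmidtNormed_snoc_castSucc_mem γ ξ n)
  have h4 : ∀ x ∈ S, inner ℂ x (gramSchmidt ℂ f (Fin.last (k + 1))) = 0 := by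
    intro x hx
    rw [hS, ← Fin.snoc_image_Iio_last γ ξ, ← span_gramSchmidt_Iio] at hx
    induction hx using Submodule.span_induction with
    | mem x hx =>
      obtain ⟨i, hi, rfl⟩ := hx
      exact gramSchmidt_orthogonal ℂ f (ne_of_lt hi)
    | zero => simp
    | add x y _ _ hx hy => rw [inner_add_left, hx, hy, add_zero]
    | smul c x _ hx => rw [inner_smul_left, hx, mul_zero]
  have h5 : ∀ x ∈ S, inner ℂ x r = 0 := by
    intro x hx
    induction hx using Submodule.span_induction with
    | mem x hx =>
      obtain ⟨i, rfl⟩ := hx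
      exact h2 i
    | zero => simp
    | add x y _ _ hx hy => rw [inner_add_left, hx, hy, add_zero]
    | smul c x _ hx => rw [inner_smul_left, hx, mul_zero]
  -- The difference of the two candidates lies in `S` and is orthogonal to `S`, hence to itself.
  have h6 : gramSchmidt ℂ f (Fin.last (k + 1)) - r ∈ S := by
    have := S.sub_mem h1 h3
    rwa [sub_sub_sub_cancel_left] at this
  rw [← sub_eq_zero, ← inner_self_eq_zero (𝕜 := ℂ), inner_sub_right, h4 _ h6, h5 _ h6, sub_zero]

end gramSchmidt

/-! ### Solving the tridiagonal system. -/

section tridiagonal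

open Finset

/-- The entries of the symmetric tridiagonal matrix with `1` on the diagonal and `κ` next to it. -/
def tridiagonal (κ : ℝ) (i j : ℕ) : ℝ := if i = j then 1 else if i + 1 = j ∨ j + 1 = i then κ else 0

variable {κ : ℝ} {u : ℕ → ℝ}

/-- By the recurrence, and by `h0` and `h1` for row `0`, the sequence `(-1) ^ j * u j` is
annihilated by every full row. Cutting it off after `n` leaves a defect only in the rows `n` and `n
+ 1`. -/
lemma sum_tridiagonal (h0 : u 0 = 1) (h1 : κ * u 1 = 1)
    (hrec : ∀ n, κ * (u (n + 2) + u n) = u (n + 1)) (i n : ℕ) :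
    ∑ j ∈ range (n + 1), (-1) ^ j * u j * tridiagonal κ i j =
      (if n + 1 = i then κ * ((-1) ^ n * u n) else 0) +
        (if n = i then κ * ((-1) ^ n * u (n + 1)) else 0) := by
  induction n with
  | zero =>
    rcases i with _ | _ | i <;> simp [tridiagonal, h0, h1]
  | succ n ih =>
    rw [sum_range_succ, ih, tridiagonal]
    have := hrec n
    rcases lt_trichotomy i (n + 1) with h | rfl | h
    · by_cases hi : n = i
      · subst hi
        simp [pow_succ, show ¬ n + 1 + 1 = n by omega]
        ring
      · simp [show ¬ n + 1 = i by omega, show ¬ i = n + 1 by omega, show ¬ n + 1 + 1 = i by omega,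
          hi, show ¬ i = n by omega]
    · simp [pow_succ]
      linear_combination (-1) ^ n * this
    · by_cases hi : n + 2 = i
      · subst hi
        simp
        ring
      · simp [show ¬ n + 1 = i by omega, show ¬ i = n + 1 by omega, show ¬ n + 1 + 1 = i by omega,
          show ¬ i = n by omega, show ¬ n = i by omega]

/-- After division by `u n * u (n + 1)`, row `i` receives `±κ / u i` from `n = i` and the opposite
from `n = i - 1`. Row `0` has no second term and keeps `κ / u 0 = κ`. -/
lemma sum_sum_tridiagonal (hu : ∀ n, u n ≠ 0) (h0 : u 0 = 1) (h1 : κ * u 1 = 1)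
    (hrec : ∀ n, κ * (u (n + 2) + u n) = u (n + 1)) {i k : ℕ} (hi : i ≤ k) :
    ∑ n ∈ range (k + 1), 1 / (u n * u (n + 1)) *
      ∑ j ∈ range (n + 1), (-1) ^ j * u j * tridiagonal κ i j = if i = 0 then κ else 0 := by
  simp only [sum_tridiagonal h0 h1 hrec, mul_add, sum_add_distrib, mul_ite, mul_zero]
  rw [sum_ite_eq' (range (k + 1)) i, if_pos (mem_range.2 (by omega))]
  rcases i with _ | i
  · simp [h0]
    field_simp [hu]
  · simp only [Nat.add_right_cancel_iff, sum_ite_eq', if_neg (Nat.succ_ne_zero i)]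
    rw [if_pos (mem_range.2 (by omega))]
    have h2 := hu i
    have h3 := hu (i + 1)
    have h4 := hu (i + 1 + 1)
    field_simp
    ring

lemma Fin.sum_Iic_eq_sum_range {M : Type*} [AddCommMonoid M] {k : ℕ} (n : Fin k) (f : ℕ → M) :
    ∑ j ∈ Finset.Iic n, f j = ∑ j ∈ range (n + 1), f j := by
  have : range ((n : ℕ) + 1) = (Finset.Iic n).map Fin.valEmbedding := by
    rw [Fin.map_valEmbedding_Iic]
    ext; simp
  rw [this, sum_map]
  rfl

variable {E : Type*} [NormedAddCommGroup E] [InnerProductSpace ℂ E] {k : ℕ}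

/-- The vector that has prescribed inner products with a family whose Gram matrix is
tridiagonal. -/
lemma inner_tridiagonal_solution (hu : ∀ n, u n ≠ 0) (h0 : u 0 = 1) (h1 : κ * u 1 = 1)
    (hrec : ∀ n, κ * (u (n + 2) + u n) = u (n + 1)) {γ : Fin (k + 1) → E}
    (hγ : ∀ i j : Fin (k + 1), inner ℂ (γ i) (γ j) = (tridiagonal κ i j : ℂ)) (i : Fin (k + 1)) :
    inner ℂ (γ i) (∑ n : Fin (k + 1), ((1 / (u n * u (n + 1)) : ℝ) : ℂ) •
      ∑ j ∈ Finset.Iic n, (((-1) ^ (j : ℕ) * u j : ℝ) : ℂ) • γ j) =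
        if i = 0 then (κ : ℂ) else 0 := by
  have h := sum_sum_tridiagonal hu h0 h1 hrec (Nat.lt_succ_iff.1 i.2)
  rw [← Fin.sum_univ_eq_sum_range (fun n => 1 / (u n * u (n + 1)) *
      ∑ j ∈ range (n + 1), (-1) ^ j * u j * tridiagonal κ i j)] at h
  simp only [← Fin.sum_Iic_eq_sum_range] at h
  simp only [inner_sum, inner_smul_right, hγ]
  have h2 : (if i = 0 then (κ : ℂ) else 0) = ((if (i : ℕ) = 0 then κ else 0 : ℝ) : ℂ) := by
    simp only [Fin.ext_iff, Fin.val_zero]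
    split_ifs <;> simp
  rw [h2, ← h]
  push_cast
  rfl

end tridiagonal

namespace Maze

/-! ### Existence and uniqueness of navigation vectors. -/

section navigation

variable {V : Type} {G : SimpleGraph V} {s g : V}

lemma apply_eq_zero_of_mem_span {S : Set (Amp G)} {a : MazeArc G} (h : ∀ x ∈ S, x a = 0) :
    ∀ x ∈ Submodule.span ℂ S, x a = 0 := by
  intro x hx
  induction hx using Submodule.span_induction with
  | mem x hx => exact h x hx
  | zero => simp
  | add x y _ _ hx hy => simp [hx, hy]
  | smul c x _ hx => simp [hx]

variable [Fintype V] [DecidableEq V] [DecidableRel G.Adj]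

/-- Navigation vectors are unique up to a phase. -/
lemma IsNavigationVector.exists_eq_smul {φ φ' : Amp G} (h : IsNavigationVector G s g φ)
    (h' : IsNavigationVector G s g φ') : ∃ c : ℂ, ‖c‖ = 1 ∧ φ' = c • φ := by
  obtain ⟨n, b, rfl, -, -, hb⟩ := h
  obtain ⟨n', b', rfl, hs', -, hb'⟩ := h'
  -- Expand `b i.castSucc` in the basis `b'` and evaluate at the start loop: only the last member of
  -- `b'` is nonzero there, so its coefficient must vanish.
  have h0 : ∀ i : Fin n, inner ℂ (b i.castSucc) (b' (Fin.last n')) = 0 := by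
    intro i
    have h1 := b'.sum_repr' (b i.castSucc)
    rw [Fin.sum_univ_castSucc] at h1
    let ev : eigenspaceNegOne G s g →ₗ[ℂ] ℂ :=
      { toFun := fun x => (x : Amp G) (.inr .startLoop)
        map_add' := fun _ _ => rfl
        map_smul' := fun _ _ => rfl }
    have hev : ∀ j : Fin n', ev (b' j.castSucc) = 0 := fun j => (hb' j).1
    have hev' : ev (b i.castSucc) = 0 := (hb i).1
    have hlast : ev (b' (Fin.last n')) ≠ 0 := hs'
    have h3 := congrArg ev h1
    simp only [map_add, map_sum, map_smul, hev, hev', mul_zero, Finset.sum_const_zero, zero_add,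
      smul_eq_mul] at h3
    exact inner_eq_zero_symm.1 ((mul_eq_zero.1 h3).resolve_right hlast)
  have h1 := b.sum_repr' (b' (Fin.last n'))
  rw [Fin.sum_univ_castSucc] at h1
  simp only [h0, zero_smul, Finset.sum_const_zero, zero_add] at h1
  refine ⟨inner ℂ (b (Fin.last n)) (b' (Fin.last n')), ?_, ?_⟩
  · have h2 := congrArg norm h1
    rwa [norm_smul, b.norm_eq_one, b'.norm_eq_one, mul_one] at h2
  · exact (congrArg Subtype.val h1).symm

open InnerProductSpace in
/-- The Gram-Schmidt process, applied to a basis of the functions in the eigenspace that vanish at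
the start and to one further function, yields a navigation vector. -/
lemma isNavigationVector_gramSchmidtNormed {k : ℕ} {γ : Fin (k + 1) → Amp G} {ξ : Amp G}
    (hsink : ∀ ψ ∈ eigenspaceNegOne G s g, ψ (.inr .toSink) = 0)
    (hγ : ∀ i, γ i ∈ eigenspaceNegOne G s g) (hγs : ∀ i, γ i (.inr .startLoop) = 0)
    (hli : LinearIndependent ℂ γ) (hξ : ξ ∈ eigenspaceNegOne G s g)
    (hξs : ξ (.inr .startLoop) ≠ 0)
    (hspan : ∀ ψ ∈ eigenspaceNegOne G s g, ψ (.inr .startLoop) = 0 →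
      ψ ∈ Submodule.span ℂ (Set.range γ)) :
    IsNavigationVector G s g
      (gramSchmidtNormed ℂ (Fin.snoc (α := fun _ => Amp G) γ ξ) (Fin.last (k + 1))) := by
  set f : Fin (k + 2) → Amp G := Fin.snoc (α := fun _ => Amp G) γ ξ with hf
  have hspan0 : ∀ x ∈ Submodule.span ℂ (Set.range γ), x (.inr .startLoop) = 0 := by
    refine apply_eq_zero_of_mem_span ?_
    rintro _ ⟨i, rfl⟩
    exact hγs i
  have hfli : LinearIndependent ℂ f :=
    linearIndependent_finSnoc.2 ⟨hli, fun h => hξs (hspan0 _ h)⟩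
  have hfV : ∀ i, f i ∈ eigenspaceNegOne G s g := by
    intro i
    refine Fin.lastCases ?_ (fun i => ?_) i
    · simpa [hf] using hξ
    · simpa [hf] using hγ i
  have hspanf : Submodule.span ℂ (Set.range (gramSchmidtNormed ℂ f)) =
      eigenspaceNegOne G s g := by
    rw [span_gramSchmidtNormed_range, span_gramSchmidt]
    apply le_antisymm
    · rw [Submodule.span_le]
      rintro _ ⟨i, rfl⟩
      exact hfV i
    · intro ψ hψ
      have hle : Submodule.span ℂ (Set.range γ) ≤ Submodule.span ℂ (Set.range f) := by
        apply Submodule.span_mono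
        rintro _ ⟨i, rfl⟩
        exact ⟨i.castSucc, by simp [hf]⟩
      have hlast : ξ ∈ Submodule.span ℂ (Set.range f) :=
        Submodule.subset_span ⟨Fin.last (k + 1), by simp [hf]⟩
      -- Subtracting the multiple of `ξ` with the same value at the start loop leads to the case
      -- covered by `hspan`.
      have h1 := hspan (ψ - (ψ (.inr .startLoop) / ξ (.inr .startLoop)) • ξ)
        (Submodule.sub_mem _ hψ (Submodule.smul_mem _ _ hξ)) (by simp [hξs])
      have h2 := Submodule.add_mem _ (hle h1)
        (Submodule.smul_mem _ (ψ (.inr .startLoop) / ξ (.inr .startLoop)) hlast)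
      rwa [sub_add_cancel] at h2
  have hmem : ∀ i, gramSchmidtNormed ℂ f i ∈ eigenspaceNegOne G s g := fun i => by
    rw [← hspanf]
    exact Submodule.subset_span ⟨i, rfl⟩
  have hon : Orthonormal ℂ fun i => (⟨gramSchmidtNormed ℂ f i, hmem i⟩ :
      eigenspaceNegOne G s g) :=
    (gramSchmidtNormed_orthonormal hfli).codRestrict _ hmem
  have htop : ⊤ ≤ Submodule.span ℂ (Set.range fun i => (⟨gramSchmidtNormed ℂ f i, hmem i⟩ :
      eigenspaceNegOne G s g)) := by
    rintro ⟨x, hx⟩ -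
    have hx' : x ∈ (Submodule.span ℂ (Set.range fun i => (⟨gramSchmidtNormed ℂ f i, hmem i⟩ :
        eigenspaceNegOne G s g))).map (eigenspaceNegOne G s g).subtype := by
      rw [Submodule.map_span, ← Set.range_comp]
      change x ∈ Submodule.span ℂ (Set.range (gramSchmidtNormed ℂ f))
      rwa [hspanf]
    obtain ⟨y, hy, rfl⟩ := hx'
    exact hy
  refine ⟨k + 1, OrthonormalBasis.mk hon htop, by simp, ?_, hsink _ (hmem _), fun i => ⟨?_, ?_⟩⟩
  · intro h
    -- Otherwise the whole basis, and with it `ξ`, would vanish at the start loop.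
    have hall : ∀ i, gramSchmidtNormed ℂ f i (.inr .startLoop) = 0 := by
      intro i
      refine Fin.lastCases h (fun i => ?_) i
      exact hspan0 _ (gramSchmidtNormed_snoc_castSucc_mem γ ξ i)
    rw [← hspanf] at hξ
    refine hξs (apply_eq_zero_of_mem_span ?_ _ hξ)
    rintro _ ⟨i, rfl⟩
    exact hall i
  · simpa using hspan0 _ (gramSchmidtNormed_snoc_castSucc_mem γ ξ i)
  · simpa using hsink _ (hmem i.castSucc)

end navigation

/-! ### Recurrence and positivity of the Chebyshev values. -/

section chebyshev

variable {l m : ℕ}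

lemma cheb_zero : cheb l m 0 = 1 := by simp [cheb]

lemma kappa_pos (hm : 1 ≤ m) : 0 < kappa l m := by
  have : (0 : ℝ) < m := by exact_mod_cast hm
  unfold kappa
  positivity

lemma kappa_mul_cheb_one (hm : 1 ≤ m) : kappa l m * cheb l m 1 = 1 := by
  have := (kappa_pos (l := l) hm).ne'
  simp [cheb]
  field_simp

lemma cheb_add_two (n : ℕ) :
    cheb l m (n + 2) = 1 / kappa l m * cheb l m (n + 1) - cheb l m n := by
  simp only [cheb]
  push_cast
  rw [Polynomial.Chebyshev.U_add_two]
  simp only [Polynomial.eval_sub, Polynomial.eval_mul, Polynomial.eval_ofNat, Polynomial.eval_X]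
  congr 2
  field_simp

lemma kappa_mul_cheb (hm : 1 ≤ m) (n : ℕ) :
    kappa l m * (cheb l m (n + 2) + cheb l m n) = cheb l m (n + 1) := by
  have := (kappa_pos (l := l) hm).ne'
  rw [cheb_add_two]
  field_simp
  ring

/-- Since `1 / κ ≥ 2`, the recurrence gives `u (n + 2) ≥ 2 * u (n + 1) - u n ≥ u (n + 1)`.
Positivity needs the monotonicity, so both are carried through the induction. -/
lemma cheb_pos (hm : 1 ≤ m) (n : ℕ) : 0 < cheb l m n ∧ cheb l m n ≤ cheb l m (n + 1) := by
  have hk := kappa_pos (l := l) hm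
  have hm' : (0 : ℝ) < m := by exact_mod_cast hm
  have h2 : 2 ≤ 1 / kappa l m := by
    rw [le_div_iff₀ hk, kappa, ← mul_div_assoc, div_le_one (by positivity)]
    have : (0 : ℝ) ≤ l := Nat.cast_nonneg l
    linarith
  induction n with
  | zero =>
    have h1 : cheb l m 1 = 1 / kappa l m := by
      rw [eq_div_iff hk.ne', mul_comm]
      exact kappa_mul_cheb_one hm
    rw [zero_add, cheb_zero, h1]
    constructor <;> linarith
  | succ n ih =>
    refine ⟨ih.1.trans_le ih.2, ?_⟩
    rw [cheb_add_two]
    nlinarith [ih.1, ih.2]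

end chebyshev

/-! ### Normalization, signs, and the basis of rectangles. -/

section ladder

variable {k l m : ℕ}

lemma inner_normalize (x y : LadderAmp k l m) :
    inner ℂ (normalize (ladderGraph k l m) x) (normalize (ladderGraph k l m) y) =
      ((‖x‖⁻¹ * ‖y‖⁻¹ : ℝ) : ℂ) * inner ℂ x y := by
  rw [normalize, normalize, inner_smul_left, inner_smul_right, Complex.conj_ofReal]
  push_cast
  ring

/-- The factor `√2` is kept apart because the norm of the path has the same factor; in their
quotient only the roots of the final formula remain. -/
lemma norm_rectangle (hl : 1 ≤ l) (hm : 1 ≤ m) (n : Fin (k + 1)) :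
    ‖rectangleVector k l m n‖ = √2 * √(2 * ((l : ℝ) + m)) := by
  have h := inner_rectangle_rectangle hl hm n n
  rw [inner_self_eq_norm_sq_to_K, if_pos rfl, if_neg (Fin.castSucc_lt_succ).ne,
    if_neg (Fin.castSucc_lt_succ).ne'] at h
  have h2 : ‖rectangleVector k l m n‖ ^ 2 = 4 * ((l : ℝ) + m) := by
    apply Complex.ofReal_injective
    push_cast
    simpa using h
  rw [← Real.sqrt_mul (by norm_num), ← Real.sqrt_sq (norm_nonneg (rectangleVector k l m n)), h2]
  congr 1
  ring

lemma norm_leftPath (hl : 1 ≤ l) : ‖leftPathVector k l m‖ = √2 * √((m : ℝ) + 3) := by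
  have h := inner_leftPath_leftPath (k := k) (m := m) hl
  rw [inner_self_eq_norm_sq_to_K] at h
  have h2 : ‖leftPathVector k l m‖ ^ 2 = 2 * ((m : ℝ) + 3) := by
    apply Complex.ofReal_injective
    push_cast
    simpa using h
  rw [← Real.sqrt_mul (by norm_num), ← Real.sqrt_sq (norm_nonneg (leftPathVector k l m)), h2]

lemma inner_cycleVector (hl : 1 ≤ l) (hm : 1 ≤ m) (i j : Fin (k + 1)) :
    inner ℂ (cycleVector k l m i) (cycleVector k l m j) =
      (((if i = j then 1 else 0) - kappa l m * (-1) ^ l *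
        ((if (i : ℕ) = j + 1 then 1 else 0) + (if (i : ℕ) + 1 = j then 1 else 0)) : ℝ) : ℂ) := by
  have hlm : (0 : ℝ) < 2 * ((l : ℝ) + m) := by
    have : (0 : ℝ) < l := by exact_mod_cast hl
    positivity
  have hc : (‖rectangleVector k l m i‖⁻¹ * ‖rectangleVector k l m j‖⁻¹ : ℝ) =
      1 / (4 * ((l : ℝ) + m)) := by
    rw [norm_rectangle hl hm, norm_rectangle hl hm, ← mul_inv, mul_mul_mul_comm,
      Real.mul_self_sqrt (by norm_num), Real.mul_self_sqrt hlm.le, one_div]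
    congr 1
    ring
  rw [cycleVector, cycleVector, inner_normalize, inner_rectangle_rectangle hl hm, hc, kappa]
  have h1 : i.castSucc = j.succ ↔ (i : ℕ) = j + 1 := by simp [Fin.ext_iff]
  have h2 : i.succ = j.castSucc ↔ (i : ℕ) + 1 = j := by simp [Fin.ext_iff]
  have hlm' : (l : ℂ) + m ≠ 0 := by
    exact_mod_cast (by omega : l + m ≠ 0)
  simp only [h1, h2]
  push_cast
  simp only [apply_ite Complex.ofReal, Complex.ofReal_one, Complex.ofReal_zero]
  field_simp
  ring

/-- The norm of the projection of the path vector on the first rectangle. -/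
noncomputable def pathOverlap (l m : ℕ) : ℝ :=
  √(2 * ((l : ℝ) + m)) / √((m : ℝ) + 3) * kappa l m

lemma pathOverlap_pos (hl : 1 ≤ l) (hm : 1 ≤ m) : 0 < pathOverlap l m := by
  have h := kappa_pos (l := l) hm
  have : (0 : ℝ) < l := by exact_mod_cast hl
  unfold pathOverlap
  positivity

lemma inner_cycleVector_path (hl : 1 ≤ l) (hm : 1 ≤ m) (i : Fin (k + 1)) :
    inner ℂ (cycleVector k l m i) (normalize (ladderGraph k l m) (leftPathVector k l m)) =
      ((if i = 0 then pathOverlap l m else 0 : ℝ) : ℂ) := by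
  have hl' : (0 : ℝ) < l := by exact_mod_cast hl
  rw [cycleVector, inner_normalize, inner_rectangle_leftPath hl hm]
  split_ifs
  · rw [norm_rectangle hl hm, norm_leftPath hl, pathOverlap, kappa,
      show (2 * (m : ℂ)) = ((2 * (m : ℝ) : ℝ) : ℂ) by push_cast; rfl, ← Complex.ofReal_mul]
    congr 1
    have h1 : √2 * √2 = (2 : ℝ) := Real.mul_self_sqrt (by norm_num)
    have h2 : √(2 * ((l : ℝ) + m)) ^ 2 = 2 * ((l : ℝ) + m) := Real.sq_sqrt (by positivity)
    have h3 : 0 < √(2 * ((l : ℝ) + m)) := by positivity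
    have h4 : 0 < √((m : ℝ) + 3) := by positivity
    generalize √(2 * ((l : ℝ) + m)) = a at h2 h3 ⊢
    rw [← h2]
    field_simp
    rw [show √2 ^ 2 = (2 : ℝ) by rw [sq]; exact h1]
  · simp

lemma exists_sign {ξ : LadderAmp k l m} {γ : Fin (k + 1) → LadderAmp k l m}
    (h : IsCycleFamily ξ γ) (n : Fin (k + 1)) :
    ∃ ε : ℝ, (ε = 1 ∨ ε = -1) ∧ γ n = (ε : ℂ) • cycleVector k l m n := by
  rcases h.eq_or_eq_neg n with h | h
  · exact ⟨1, Or.inl rfl, by simp [h]⟩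
  · exact ⟨-1, Or.inr rfl, by simp [h]⟩

lemma inner_signed (hl : 1 ≤ l) (hm : 1 ≤ m) (ε ε' : ℝ) (i j : Fin (k + 1)) :
    inner ℂ ((ε : ℂ) • cycleVector k l m i) ((ε' : ℂ) • cycleVector k l m j) =
      ((ε * ε' * ((if i = j then 1 else 0) - kappa l m * (-1) ^ l *
        ((if (i : ℕ) = j + 1 then 1 else 0) + (if (i : ℕ) + 1 = j then 1 else 0))) : ℝ) : ℂ) := by
  rw [inner_smul_left, inner_smul_right, Complex.conj_ofReal, inner_cycleVector hl hm]
  push_cast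
  ring

/-- The Gram matrix of the rectangles. -/
lemma IsCycleFamily.inner_eq_tridiagonal (hl : 1 ≤ l) (hm : 1 ≤ m) {ξ : LadderAmp k l m}
    {γ : Fin (k + 1) → LadderAmp k l m} (h : IsCycleFamily ξ γ) (i j : Fin (k + 1)) :
    inner ℂ (γ i) (γ j) = (tridiagonal (kappa l m) i j : ℂ) := by
  choose ε hε hγ using exists_sign h
  have hk := kappa_pos (l := l) hm
  -- The left side is `±1`, and times `κ > 0` it is the inner product of two neighbours, which is
  -- nonnegative by the choice of signs.
  have hsucc : ∀ n : Fin k, ε n.castSucc * ε n.succ * -(-1) ^ l = 1 := by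
    intro n
    have h1 := h.inner_succ_nonneg n
    rw [hγ, hγ, inner_signed hl hm, Complex.ofReal_re, if_neg (Fin.castSucc_lt_succ).ne,
      if_neg (by simp only [Fin.val_castSucc, Fin.val_succ]; omega), if_pos (by simp)] at h1
    have h2 : 0 ≤ kappa l m * (ε n.castSucc * ε n.succ * -(-1) ^ l) := by linarith
    have h3 := nonneg_of_mul_nonneg_right h2 hk
    rcases hε n.castSucc with h4 | h4 <;> rcases hε n.succ with h5 | h5 <;>
      rcases neg_one_pow_eq_or ℝ l with h6 | h6 <;> rw [h4, h5, h6] at h3 ⊢ <;> linarith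
  rw [hγ, hγ, inner_signed hl hm]
  congr 1
  rw [tridiagonal]
  by_cases hij : i = j
  · subst hij
    have : ε i * ε i = 1 := by rcases hε i with h | h <;> rw [h] <;> norm_num
    simp [this]
  · have hij' : (i : ℕ) ≠ j := fun h => hij (Fin.ext h)
    by_cases h1 : (i : ℕ) + 1 = j
    · have h2 := hsucc ⟨i, by omega⟩
      have hi : (⟨i, by omega⟩ : Fin k).castSucc = i := rfl
      have hj : (⟨i, by omega⟩ : Fin k).succ = j := Fin.ext h1
      rw [hi, hj] at h2
      rw [if_neg hij, if_neg hij', if_neg (by omega), if_pos h1, if_pos (Or.inl h1)]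
      linear_combination kappa l m * h2
    · by_cases h3 : (j : ℕ) + 1 = i
      · have h2 := hsucc ⟨j, by omega⟩
        have hj : (⟨j, by omega⟩ : Fin k).castSucc = j := rfl
        have hi : (⟨j, by omega⟩ : Fin k).succ = i := Fin.ext h3
        rw [hi, hj] at h2
        rw [if_neg hij, if_neg hij', if_pos h3.symm, if_neg h1, if_pos (Or.inr h3)]
        linear_combination kappa l m * h2
      · rw [if_neg hij, if_neg hij', if_neg (Ne.symm h3), if_neg h1, if_neg (by tauto)]
        ring

/-- The overlap with the first rectangle is strictly positive, so the sign of `γ 0` is forced; for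
the other rectangles the sign is irrelevant. -/
lemma IsCycleFamily.inner_path (hl : 1 ≤ l) (hm : 1 ≤ m) {ξ : LadderAmp k l m}
    (hξ : ξ = normalize (ladderGraph k l m) (leftPathVector k l m))
    {γ : Fin (k + 1) → LadderAmp k l m} (h : IsCycleFamily ξ γ) (i : Fin (k + 1)) :
    inner ℂ (γ i) ξ = ((if i = 0 then pathOverlap l m else 0 : ℝ) : ℂ) := by
  obtain ⟨ε, hε, hγ⟩ := exists_sign h i
  have h1 : inner ℂ (γ i) ξ = ((ε * (if i = 0 then pathOverlap l m else 0) : ℝ) : ℂ) := by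
    rw [hγ, inner_smul_left, Complex.conj_ofReal, hξ, inner_cycleVector_path hl hm,
      Complex.ofReal_mul]
  rw [h1]
  congr 1
  split_ifs with hi
  · subst hi
    have h2 := h.inner_path_nonneg
    rw [h1, Complex.ofReal_re, if_pos rfl] at h2
    have h3 := nonneg_of_mul_nonneg_left h2 (pathOverlap_pos hl hm)
    rcases hε with h | h
    · rw [h, one_mul]
    · rw [h] at h3
      norm_num at h3
  · simp

lemma exists_isCycleFamily (hl : 1 ≤ l) (hm : 1 ≤ m) {ξ : LadderAmp k l m}
    (hξ : ξ = normalize (ladderGraph k l m) (leftPathVector k l m)) :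
    ∃ γ : Fin (k + 1) → LadderAmp k l m, IsCycleFamily ξ γ := by
  have hk := kappa_pos (l := l) hm
  -- Neighbouring cycle vectors have inner product `-(-1) ^ l * κ`; a factor `-(-1) ^ l` from each
  -- rectangle to the next makes it positive.
  refine ⟨fun n => (((-(-1) ^ l) ^ (n : ℕ) : ℝ) : ℂ) • cycleVector k l m n, ?_, ?_, ?_⟩
  · intro n
    have : (-(-1 : ℝ) ^ l) ^ (n : ℕ) = 1 ∨ (-(-1 : ℝ) ^ l) ^ (n : ℕ) = -1 := by
      rcases neg_one_pow_eq_or ℝ l with h | h <;> rw [h]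
      · exact neg_one_pow_eq_or ℝ n
      · simp
    rcases this with h | h <;> rw [h] <;> simp
  · intro n
    rw [inner_signed hl hm, Complex.ofReal_re, if_neg (Fin.castSucc_lt_succ).ne,
      if_neg (by simp only [Fin.val_castSucc, Fin.val_succ]; omega), if_pos (by simp),
      Fin.val_castSucc, Fin.val_succ]
    have h1 : ((-1 : ℝ) ^ l) * (-1) ^ l = 1 := by rw [← mul_pow]; simp
    have h2 : (-(-1 : ℝ) ^ l) ^ (n : ℕ) * (-(-1 : ℝ) ^ l) ^ (n : ℕ) = 1 := by
      rw [← mul_pow, neg_mul_neg, h1, one_pow]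
    have h3 : (-(-1 : ℝ) ^ l) ^ (n : ℕ) * (-(-1) ^ l) ^ ((n : ℕ) + 1) *
        (0 - kappa l m * (-1) ^ l * (0 + 1)) = kappa l m := by
      rw [pow_succ]
      linear_combination kappa l m * h2 + kappa l m *
        (-(-1 : ℝ) ^ l) ^ (n : ℕ) * (-(-1 : ℝ) ^ l) ^ (n : ℕ) * h1
    rw [h3]
    exact hk.le
  · rw [Fin.val_zero, pow_zero, Complex.ofReal_one, one_smul, hξ, inner_cycleVector_path hl hm,
      Complex.ofReal_re, if_pos rfl]
    exact (pathOverlap_pos hl hm).le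

lemma cycleVector_mem (hl : 1 ≤ l) (hm : 1 ≤ m) (n : Fin (k + 1)) :
    cycleVector k l m n ∈ eigenspaceNegOne (ladderGraph k l m) (start k l m) (goal k l m) :=
  Submodule.smul_mem _ _
    ((mem_eigenspaceNegOne_iff ladderGraph_preconnected _).2 (isBalanced_rectangle hl hm n))

/-- The value of a cycle family on the first top edge of a rectangle. -/
lemma IsCycleFamily.exists_inner_top_edge (hl : 1 ≤ l) (hm : 1 ≤ m) {ξ : LadderAmp k l m}
    {γ : Fin (k + 1) → LadderAmp k l m} (h : IsCycleFamily ξ γ) (j : Fin (k + 1)) :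
    ∃ c : ℂ, c ≠ 0 ∧ ∀ n, inner ℂ
      (edge k l m (top n (Fin.castSucc ⟨0, hl⟩)) (top n (Fin.succ ⟨0, hl⟩))) (γ j) =
        if n = j then c else 0 := by
  obtain ⟨ε, hε, hγ⟩ := exists_sign h j
  have hε0 : ε ≠ 0 := by rcases hε with h | h <;> rw [h] <;> norm_num
  have hl' : (0 : ℝ) < l := by exact_mod_cast hl
  have hn : ‖rectangleVector k l m j‖ ≠ 0 := by
    rw [norm_rectangle hl hm]
    positivity
  refine ⟨ε * (((‖rectangleVector k l m j‖⁻¹ : ℝ) : ℂ) * (2 * (-1) ^ m)), ?_, fun n => ?_⟩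
  · refine mul_ne_zero (by exact_mod_cast hε0) (mul_ne_zero (by exact_mod_cast inv_ne_zero hn) ?_)
    exact mul_ne_zero two_ne_zero (pow_ne_zero _ (by norm_num))
  · rw [hγ, cycleVector, normalize, inner_smul_right, inner_smul_right,
      inner_top_edge_rectangle hl hm]
    split_ifs <;> simp

/-- The first top edges form a dual system up to nonzero factors: each of them meets exactly one
rectangle. -/
lemma IsCycleFamily.linearIndependent (hl : 1 ≤ l) (hm : 1 ≤ m) {ξ : LadderAmp k l m}
    {γ : Fin (k + 1) → LadderAmp k l m} (h : IsCycleFamily ξ γ) : LinearIndependent ℂ γ := by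
  choose c hc hinner using h.exists_inner_top_edge hl hm
  rw [Fintype.linearIndependent_iff]
  intro a ha i
  have h1 := congrArg (fun x => inner ℂ
    (edge k l m (top i (Fin.castSucc ⟨0, hl⟩)) (top i (Fin.succ ⟨0, hl⟩))) x) ha
  simp only [inner_sum, inner_smul_right, hinner, mul_ite, mul_zero, Finset.sum_ite_eq,
    Finset.mem_univ, if_true, inner_zero_right] at h1
  exact (mul_eq_zero.1 h1).resolve_right (hc i)

lemma IsCycleFamily.mem (hl : 1 ≤ l) (hm : 1 ≤ m) {ξ : LadderAmp k l m}
    {γ : Fin (k + 1) → LadderAmp k l m} (h : IsCycleFamily ξ γ) (n : Fin (k + 1)) :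
    γ n ∈ eigenspaceNegOne (ladderGraph k l m) (start k l m) (goal k l m) := by
  obtain ⟨ε, -, hγ⟩ := exists_sign h n
  rw [hγ]
  exact Submodule.smul_mem _ _ (cycleVector_mem hl hm n)

lemma IsCycleFamily.startLoop (hl : 1 ≤ l) (hm : 1 ≤ m) {ξ : LadderAmp k l m}
    {γ : Fin (k + 1) → LadderAmp k l m} (h : IsCycleFamily ξ γ) (n : Fin (k + 1)) :
    γ n (.inr .startLoop) = 0 := by
  obtain ⟨ε, -, hγ⟩ := exists_sign h n
  rw [hγ, cycleVector, normalize, PiLp.smul_apply, PiLp.smul_apply, rectangle_startLoop hl hm,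
    smul_zero, smul_zero]

/-- The rectangles span the functions in the eigenspace that vanish at the start. -/
lemma IsCycleFamily.mem_span (hl : 1 ≤ l) (hm : 1 ≤ m) {ξ : LadderAmp k l m}
    {γ : Fin (k + 1) → LadderAmp k l m} (h : IsCycleFamily ξ γ) {ψ : LadderAmp k l m}
    (hψ : ψ ∈ eigenspaceNegOne (ladderGraph k l m) (start k l m) (goal k l m))
    (hs : ψ (.inr .startLoop) = 0) : ψ ∈ Submodule.span ℂ (Set.range γ) := by
  choose c hc hinner using h.exists_inner_top_edge hl hm
  set e : Fin (k + 1) → LadderAmp k l m := fun n =>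
    edge k l m (top n (Fin.castSucc ⟨0, hl⟩)) (top n (Fin.succ ⟨0, hl⟩)) with he
  -- The coefficients make `x` agree with `ψ` on the first top edge of each rectangle, so that
  -- `balanced_eq_zero` applies to the difference.
  set x : LadderAmp k l m := ∑ n, (inner ℂ (e n) ψ / c n) • γ n with hx
  have hxspan : x ∈ Submodule.span ℂ (Set.range γ) :=
    Submodule.sum_mem _ fun n _ => Submodule.smul_mem _ _ (Submodule.subset_span ⟨n, rfl⟩)
  have hxV : x ∈ eigenspaceNegOne (ladderGraph k l m) (start k l m) (goal k l m) :=
    Submodule.sum_mem _ fun n _ => Submodule.smul_mem _ _ (h.mem hl hm n)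
  have hxs : x (.inr .startLoop) = 0 := by
    refine apply_eq_zero_of_mem_span ?_ x hxspan
    rintro _ ⟨n, rfl⟩
    exact h.startLoop hl hm n
  have h0 : ψ - x = 0 := by
    refine balanced_eq_zero hl hm ((mem_eigenspaceNegOne_iff ladderGraph_preconnected _).1
      (Submodule.sub_mem _ hψ hxV)) (by rw [PiLp.sub_apply, hs, hxs, sub_zero]) fun n => ?_
    rw [inner_sub_right, hx, inner_sum]
    simp only [inner_smul_right, hinner, mul_ite, mul_zero, Finset.sum_ite_eq, Finset.mem_univ,
      if_true]
    rw [div_mul_cancel₀ _ (hc n), sub_self]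
  rw [sub_eq_zero.1 h0]
  exact hxspan

end ladder

/-! ### The residual of the path vector: formula, norm and positivity. -/

section ladder

variable {k l m : ℕ}

lemma residual_eq_gramSchmidt (γ : Fin (k + 1) → LadderAmp k l m) (ξ : LadderAmp k l m) :
    residual γ ξ = InnerProductSpace.gramSchmidt ℂ
      (Fin.snoc (α := fun _ => LadderAmp k l m) γ ξ) (Fin.last (k + 1)) :=
  (gramSchmidt_snoc_last_eq γ ξ).symm

lemma orthonormalized_last (γ : Fin (k + 1) → LadderAmp k l m) (ξ : LadderAmp k l m) :
    orthonormalized γ ξ (Fin.last (k + 1)) =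
      ((‖residual γ ξ‖⁻¹ : ℝ) : ℂ) • residual γ ξ := by
  rw [residual_eq_gramSchmidt, orthonormalized, InnerProductSpace.gramSchmidtNormed]
  push_cast
  rfl

variable (k l m) in
/-- The combination of the rectangles that is a multiple of the projection of the path vector. -/
noncomputable def chebCombination (γ : Fin (k + 1) → LadderAmp k l m) : LadderAmp k l m :=
  ∑ n : Fin (k + 1), ((1 / (cheb l m n * cheb l m (n + 1)) : ℝ) : ℂ) •
    ∑ j ∈ Finset.Iic n, (((-1) ^ (j : ℕ) * cheb l m j : ℝ) : ℂ) • γ j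

lemma chebCombination_mem_span (γ : Fin (k + 1) → LadderAmp k l m) :
    chebCombination k l m γ ∈ Submodule.span ℂ (Set.range γ) :=
  Submodule.sum_mem _ fun _ _ => Submodule.smul_mem _ _ <| Submodule.sum_mem _ fun j _ =>
    Submodule.smul_mem _ _ (Submodule.subset_span ⟨j, rfl⟩)

lemma IsCycleFamily.inner_chebCombination (hl : 1 ≤ l) (hm : 1 ≤ m) {ξ : LadderAmp k l m}
    {γ : Fin (k + 1) → LadderAmp k l m} (h : IsCycleFamily ξ γ) (i : Fin (k + 1)) :
    inner ℂ (γ i) (chebCombination k l m γ) = if i = 0 then (kappa l m : ℂ) else 0 :=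
  inner_tridiagonal_solution (u := cheb l m) (fun n => (cheb_pos hm n).1.ne') cheb_zero
    (kappa_mul_cheb_one hm) (kappa_mul_cheb hm) (h.inner_eq_tridiagonal hl hm) i

/-- The combination has inner product `κ` with `γ 0`, and `pathOverlap` is `κ` times the scalar used
here. -/
lemma IsCycleFamily.inner_residual (hl : 1 ≤ l) (hm : 1 ≤ m) {ξ : LadderAmp k l m}
    (hξ : ξ = normalize (ladderGraph k l m) (leftPathVector k l m))
    {γ : Fin (k + 1) → LadderAmp k l m} (h : IsCycleFamily ξ γ) (i : Fin (k + 1)) :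
    inner ℂ (γ i) (ξ - ((√(2 * ((l : ℝ) + (m : ℝ))) / √((m : ℝ) + 3) : ℝ) : ℂ) •
      chebCombination k l m γ) = 0 := by
  rw [inner_sub_right, inner_smul_right, h.inner_path hl hm hξ, h.inner_chebCombination hl hm,
    pathOverlap]
  split_ifs
  · rw [Complex.ofReal_mul, sub_self]
  · simp

lemma IsCycleFamily.residual_eq (hl : 1 ≤ l) (hm : 1 ≤ m) {ξ : LadderAmp k l m}
    (hξ : ξ = normalize (ladderGraph k l m) (leftPathVector k l m))
    {γ : Fin (k + 1) → LadderAmp k l m} (h : IsCycleFamily ξ γ) :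
    residual γ ξ = ξ - ((√(2 * ((l : ℝ) + (m : ℝ))) / √((m : ℝ) + 3) : ℝ) : ℂ) •
      chebCombination k l m γ := by
  rw [residual_eq_gramSchmidt]
  refine gramSchmidt_snoc_last_eq_of_orthogonal ?_ (h.inner_residual hl hm hξ)
  rw [sub_sub_cancel]
  exact Submodule.smul_mem _ _ (chebCombination_mem_span γ)

lemma IsCycleFamily.inner_path_chebCombination (hl : 1 ≤ l) (hm : 1 ≤ m) {ξ : LadderAmp k l m}
    (hξ : ξ = normalize (ladderGraph k l m) (leftPathVector k l m))
    {γ : Fin (k + 1) → LadderAmp k l m} (h : IsCycleFamily ξ γ) :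
    inner ℂ ξ (chebCombination k l m γ) = ((pathOverlap l m *
      ∑ n : Fin (k + 1), 1 / (cheb l m n * cheb l m (n + 1)) : ℝ) : ℂ) := by
  have h1 : ∀ i, inner ℂ ξ (γ i) = ((if i = 0 then pathOverlap l m else 0 : ℝ) : ℂ) := by
    intro i
    rw [← inner_conj_symm, h.inner_path hl hm hξ, Complex.conj_ofReal]
  -- Only `j = 0` meets the path; it occurs in every inner sum, with coefficient `u 0 = 1`.
  have h2 : ∀ n : Fin (k + 1), ∑ j ∈ Finset.Iic n, (((-1) ^ (j : ℕ) * cheb l m j : ℝ) : ℂ) *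
      ((if j = 0 then pathOverlap l m else 0 : ℝ) : ℂ) = pathOverlap l m := by
    intro n
    rw [Finset.sum_eq_single 0]
    · simp [cheb_zero]
    · intro j _ hj
      simp [hj]
    · intro h
      exact absurd (Finset.mem_Iic.2 (Fin.zero_le n)) h
  simp only [chebCombination, inner_sum, inner_smul_right, h1, h2]
  rw [← Finset.sum_mul]
  push_cast
  ring

lemma norm_path (hl : 1 ≤ l) {ξ : LadderAmp k l m}
    (hξ : ξ = normalize (ladderGraph k l m) (leftPathVector k l m)) : ‖ξ‖ = 1 := by
  have h : 0 < ‖leftPathVector k l m‖ := by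
    rw [norm_leftPath hl]
    positivity
  rw [hξ, normalize, norm_smul, Complex.norm_real, norm_inv, norm_norm, inv_mul_cancel₀ h.ne']

lemma IsCycleFamily.norm_residual_sq (hl : 1 ≤ l) (hm : 1 ≤ m) {ξ : LadderAmp k l m}
    (hξ : ξ = normalize (ladderGraph k l m) (leftPathVector k l m))
    {γ : Fin (k + 1) → LadderAmp k l m} (h : IsCycleFamily ξ γ) :
    ‖residual γ ξ‖ ^ 2 = 1 - (m : ℝ) / ((m : ℝ) + 3) *
      ∑ n : Fin (k + 1), 1 / (cheb l m n * cheb l m (n + 1)) := by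
  have hl' : (0 : ℝ) < l := by exact_mod_cast hl
  set C : ℝ := √(2 * ((l : ℝ) + (m : ℝ))) / √((m : ℝ) + 3) with hC
  set v := chebCombination k l m γ with hv
  have hr : residual γ ξ = ξ - (C : ℂ) • v := h.residual_eq hl hm hξ
  have hvr : inner ℂ v (residual γ ξ) = 0 := by
    rw [hv, chebCombination, sum_inner]
    refine Finset.sum_eq_zero fun n _ => ?_
    rw [inner_smul_left, sum_inner, Finset.sum_eq_zero, mul_zero]
    intro j _
    rw [inner_smul_left, h.residual_eq hl hm hξ, h.inner_residual hl hm hξ, mul_zero]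
  -- The residual is orthogonal to `v`, so its squared norm is its inner product with the unit
  -- vector `ξ`.
  have h1 : inner ℂ (residual γ ξ) (residual γ ξ) = 1 - (C : ℂ) * inner ℂ ξ v := by
    calc inner ℂ (residual γ ξ) (residual γ ξ)
        = inner ℂ (ξ - (C : ℂ) • v) (residual γ ξ) := by rw [← hr]
      _ = inner ℂ ξ (residual γ ξ) := by
          rw [inner_sub_left, inner_smul_left, hvr, mul_zero, sub_zero]
      _ = _ := by
          rw [hr, inner_sub_right, inner_smul_right, inner_self_eq_norm_sq_to_K,
            norm_path hl hξ]
          simp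
  -- This is `C ^ 2 * κ`, in which the factor `2 * (l + m)` cancels.
  have hCC : C * pathOverlap l m = (m : ℝ) / ((m : ℝ) + 3) := by
    rw [pathOverlap, ← hC, ← mul_assoc, hC, ← sq, div_pow, Real.sq_sqrt (by positivity),
      Real.sq_sqrt (by positivity), kappa]
    field_simp
  rw [inner_self_eq_norm_sq_to_K, h.inner_path_chebCombination hl hm hξ] at h1
  apply Complex.ofReal_injective
  rw [← hCC, mul_assoc, Complex.ofReal_sub, Complex.ofReal_mul C, Complex.ofReal_one, ← h1]
  simp

lemma path_startLoop_ne_zero (hl : 1 ≤ l) {ξ : LadderAmp k l m}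
    (hξ : ξ = normalize (ladderGraph k l m) (leftPathVector k l m)) :
    ξ (.inr .startLoop) ≠ 0 := by
  have h : ‖leftPathVector k l m‖ ≠ 0 := by
    rw [norm_leftPath hl]
    positivity
  rw [hξ, normalize, PiLp.smul_apply, leftPath_startLoop, smul_eq_mul, mul_one]
  exact Complex.ofReal_ne_zero.2 (inv_ne_zero h)

/-- A zero residual would put `ξ` into the span of the rectangles, all of which vanish at the start
loop, where `ξ` does not. -/
lemma IsCycleFamily.norm_residual_pos (hl : 1 ≤ l) (hm : 1 ≤ m) {ξ : LadderAmp k l m}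
    (hξ : ξ = normalize (ladderGraph k l m) (leftPathVector k l m))
    {γ : Fin (k + 1) → LadderAmp k l m} (h : IsCycleFamily ξ γ) : 0 < ‖residual γ ξ‖ := by
  rw [norm_pos_iff]
  intro h0
  have hspan : ξ ∈ Submodule.span ℂ (Set.range γ) := by
    rw [h.residual_eq hl hm hξ, sub_eq_zero] at h0
    rw [h0]
    exact Submodule.smul_mem _ _ (chebCombination_mem_span γ)
  refine path_startLoop_ne_zero hl hξ (apply_eq_zero_of_mem_span ?_ ξ hspan)
  rintro _ ⟨n, rfl⟩
  exact h.startLoop hl hm n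

lemma IsCycleFamily.isNavigationVector (hl : 1 ≤ l) (hm : 1 ≤ m) {ξ : LadderAmp k l m}
    (hξ : ξ = normalize (ladderGraph k l m) (leftPathVector k l m))
    {γ : Fin (k + 1) → LadderAmp k l m} (h : IsCycleFamily ξ γ) :
    IsNavigationVector (ladderGraph k l m) (start k l m) (goal k l m)
      (orthonormalized γ ξ (Fin.last (k + 1))) :=
  isNavigationVector_gramSchmidtNormed
    (fun ψ hψ => ((mem_eigenspaceNegOne_iff ladderGraph_preconnected ψ).1 hψ).apply_toSink)
    (h.mem hl hm) (h.startLoop hl hm) (h.linearIndependent hl hm)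
    (hξ ▸ Submodule.smul_mem _ _
      ((mem_eigenspaceNegOne_iff ladderGraph_preconnected _).2 isBalanced_leftPath))
    (path_startLoop_ne_zero hl hξ) (fun _ hψ hs => h.mem_span hl hm hψ hs)

end ladder

end Maze

theorem mainTheorem4 (k l m : ℕ) (hl : 1 ≤ l) (hm : 1 ≤ m) :
    (∃! p : (Maze.ladderGraph k l m).Walk (Maze.start k l m) (Maze.goal k l m),
      p.length = (Maze.ladderGraph k l m).dist (Maze.start k l m) (Maze.goal k l m)) ∧
    ∀ p : (Maze.ladderGraph k l m).Walk (Maze.start k l m) (Maze.goal k l m),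
      p.length = (Maze.ladderGraph k l m).dist (Maze.start k l m) (Maze.goal k l m) →
    ∀ ξ : Maze.LadderAmp k l m,
      ξ = Maze.pathVector (Maze.ladderGraph k l m) (Maze.start k l m) (Maze.goal k l m) p →
    (∃ γ : Fin (k + 1) → Maze.LadderAmp k l m, Maze.IsCycleFamily ξ γ) ∧
    ∀ γ : Fin (k + 1) → Maze.LadderAmp k l m, Maze.IsCycleFamily ξ γ →
    ∀ φ : Maze.LadderAmp k l m, φ = Maze.orthonormalized γ ξ (Fin.last (k + 1)) →
      Maze.IsNavigationVector (Maze.ladderGraph k l m) (Maze.start k l m) (Maze.goal k l m) φ ∧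
      (∀ φ' : Maze.LadderAmp k l m,
        Maze.IsNavigationVector (Maze.ladderGraph k l m) (Maze.start k l m) (Maze.goal k l m) φ' →
          ∃ c : ℂ, ‖c‖ = 1 ∧ φ' = c • φ) ∧
      0 < ‖Maze.residual γ ξ‖ ∧
      ‖Maze.residual γ ξ‖ ^ 2 =
        1 - (m : ℝ) / ((m : ℝ) + 3) *
          ∑ n : Fin (k + 1), 1 / (Maze.cheb l m n * Maze.cheb l m (n + 1)) ∧
      φ = ((‖Maze.residual γ ξ‖⁻¹ : ℝ) : ℂ) •
        (ξ - ((√(2 * ((l : ℝ) + (m : ℝ))) / √((m : ℝ) + 3) : ℝ) : ℂ) •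
          ∑ n : Fin (k + 1), ((1 / (Maze.cheb l m n * Maze.cheb l m (n + 1)) : ℝ) : ℂ) •
            ∑ j ∈ Finset.Iic n, (((-1) ^ (j : ℕ) * Maze.cheb l m j : ℝ) : ℂ) • γ j) := by
  refine ⟨Maze.existsUnique_shortest, fun p hp ξ hξ' => ?_⟩
  have hξ : ξ = Maze.normalize (Maze.ladderGraph k l m) (Maze.leftPathVector k l m) := by
    rw [hξ', Maze.pathVector, Maze.alternating_shortest hp]
  refine ⟨Maze.exists_isCycleFamily hl hm hξ, fun γ hγ φ hφ => ?_⟩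
  have hnav := hφ ▸ hγ.isNavigationVector hl hm hξ
  refine ⟨hnav, fun φ' h' => hnav.exists_eq_smul h', hγ.norm_residual_pos hl hm hξ,
    hγ.norm_residual_sq hl hm hξ, ?_⟩
  rw [hφ, Maze.orthonormalized_last]
  congr 1
  exact hγ.residual_eq hl hm hξ
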